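/- Let $n\ge 1$, let $\Sigma$ be a real symmetric positive semidefinite $n\times n$ matrix with unit diagonal, let $\nu>0$, let $X=(X_1,\dots,X_n)\sim N_n(0,\Sigma)$, and let $Z\sim\chi_\nu/\sqrt{\nu}$ be independent of $X$. Put $T_i=Z^{-1}X_i$, $i=1,\dots,n$. For random variables $Y_1,\dots,Y_n$ with marginal cdfs $F_1,\dots,F_n$ and ordered values $Y_{1:n}\le\dots\le Y_{n:n}$, consider the following two inequalities. (1.2) $P\{Y_{1:n}\ge a_1,\dots,Y_{n:n}\ge a_n\}\ \ge\ 1-\frac1n\sum_{i=1}^nF_i(a_n)$, for real constants $a_1\le\dots\le a_n$ such that, for every $i$, $j^{-1}F_i(a_j)$ is nondecreasing in $j=1,\dots,n$. (1.3) $P\{Y_{1:n}\le b_1,\dots,Y_{n:n}\le b_n\}\ \ge\ \frac1n\sum_{i=1}^nF_i(b_1)$, for real constants $b_1\le\dots\le b_n$ such that, for every $i$, $j^{-1}[1-F_i(b_{n-j+1})]$ is nondecreasing in $j=1,\dots,n$. Then: (i) If all off-diagonal entries of $\Sigma$ are nonnegative, then for $Y_i=T_i$ inequality (1.2) holds for all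 such $a_1\le\dots\le a_n$ with $a_n\le 0$, and inequality (1.3) holds for all such $b_1\le\dots\le b_n$ with $b_1\ge 0$. (ii) If $\Sigma$ is invertible and, for some diagonal matrix $D$ with diagonal entries $\pm1$, all off-diagonal entries of $-D\Sigma^{-1}D$ are nonnegative, then for $Y_i=|T_i|$ inequality (1.2) holds for all such $a_1\le\dots\le a_n$, and inequality (1.3) holds for all such $b_1\le\dots\le b_n$. -/

import Mathlib

open MeasureTheory ProbabilityTheory
open scoped Matrix

noncomputable section

namespace Simes

/-- The chi-squared distribution with `ν` degrees of freedom, that is, the Gamma distribution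
with shape `ν / 2` and rate `1 / 2`. -/
def chiSquaredMeasure (ν : ℝ) : Measure ℝ := gammaMeasure (ν / 2) (1 / 2)

/-- The law of `χ_ν / √ν`, where `χ_ν` is the nonnegative square root of a chi-squared random
variable with `ν` degrees of freedom. -/
def scaledChiMeasure (ν : ℝ) : Measure ℝ :=
  (chiSquaredMeasure ν).map (fun y => Real.sqrt y / Real.sqrt ν)

/-- The order statistics `x_{1:n} ≤ ... ≤ x_{n:n}` of `x_1, ..., x_n` (indices start at `0`, so
`orderStat x j` is `x_{j+1:n}`). -/
def orderStat {n : ℕ} (x : Fin n → ℝ) : Fin n → ℝ := x ∘ Tuple.sort x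

/-- The index of the first of `n ≥ 1` entries. -/
def firstIdx {n : ℕ} (hn : 0 < n) : Fin n := ⟨0, hn⟩

/-- The index of the last of `n ≥ 1` entries. -/
def lastIdx {n : ℕ} (hn : 0 < n) : Fin n := ⟨n - 1, Nat.sub_lt hn Nat.one_pos⟩

variable {Ω : Type*} [MeasurableSpace Ω] {n : ℕ}

/-- The cdf `F_i` of the `i`-th variable. -/
def marginalCDF (P : Measure Ω) (Y : Fin n → Ω → ℝ) (i : Fin n) : ℝ → ℝ :=
  fun x => cdf (P.map (Y i)) x

/-- The conditions on the constants `a_1 ≤ ... ≤ a_n` in the lower Simes inequality: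
`F_i(a_j) / j` is nondecreasing in `j = 1, ..., n`, for every `i`. -/
def LowerAdmissible (P : Measure Ω) (Y : Fin n → Ω → ℝ) (a : Fin n → ℝ) : Prop :=
  Monotone a ∧
    ∀ i : Fin n, Monotone fun j : Fin n => ((j : ℝ) + 1)⁻¹ * marginalCDF P Y i (a j)

/-- The lower Simes inequality
`P{Y_{1:n} ≥ a_1, ..., Y_{n:n} ≥ a_n} ≥ 1 - (1/n) ∑ F_i(a_n)`. -/
def LowerInequality (hn : 0 < n) (P : Measure Ω) (Y : Fin n → Ω → ℝ) (a : Fin n → ℝ) : Prop :=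
  1 - (1 / (n : ℝ)) * ∑ i : Fin n, marginalCDF P Y i (a (lastIdx hn)) ≤
    P.real {ω | ∀ j : Fin n, a j ≤ orderStat (fun i => Y i ω) j}

/-- The conditions on the constants `b_1 ≤ ... ≤ b_n` in the upper Simes inequality:
`(1 - F_i(b_{n-j+1})) / j` is nondecreasing in `j = 1, ..., n`, for every `i`. -/
def UpperAdmissible (P : Measure Ω) (Y : Fin n → Ω → ℝ) (b : Fin n → ℝ) : Prop :=
  Monotone b ∧
    ∀ i : Fin n, Monotone fun j : Fin n =>
      ((j : ℝ) + 1)⁻¹ * (1 - marginalCDF P Y i (b (Fin.rev j)))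

/-- The upper Simes inequality
`P{Y_{1:n} ≤ b_1, ..., Y_{n:n} ≤ b_n} ≥ (1/n) ∑ F_i(b_1)`. -/
def UpperInequality (hn : 0 < n) (P : Measure Ω) (Y : Fin n → Ω → ℝ) (b : Fin n → ℝ) : Prop :=
  (1 / (n : ℝ)) * ∑ i : Fin n, marginalCDF P Y i (b (firstIdx hn)) ≤
    P.real {ω | ∀ j : Fin n, orderStat (fun i => Y i ω) j ≤ b j}

end Simes

end

/-! Both inequalities reduce to one dependence property, `TailDependent`: for each `i` and `r`, the
conditional probability of `tailEvent Y a i r` given `Y i < t` decreases in `t`.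

The bad event says that for some `k` at least `k + 1` of the variables lie below `a k`. At the
largest such `k`, every such index `i` satisfies `tailEvent` at level `k` but not at level `k + 1`,
so the indicator of the bad event is at most a sum over `i` and `k` of indicators weighted by `1 /
(k + 1)`. For fixed `i` the probabilities telescope to `F_i(a_n) / n`, using dependence together
with the monotonicity of `F_i(a_j) / j` (`telescoping_bound`, `simes_of_tailDependent`). The upper
inequality is the lower one for `-Y` with reversed thresholds.

To prove dependence, replace `(X_i, Z)` by `y = X_i / Z` and `w = X_i ^ 2 + ν Z ^ 2`, which are
independent (`lintegral_polar`). At fixed `w`, a larger `|y|` means a larger `|X_i|` and a smaller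
`Z`. It then suffices that the conditional probability of the tail event given `(X_i, Z)` changes in
the right direction along these arcs (`ratio_of_conditional`).

For part (i), `X_j = S i j * X_i + residual` with a residual independent of `X_i`. As `y` moves down
on the negative side, `X_j` falls since `S i j ≥ 0`, and the bound `a k * Z` rises since `a k ≤ 0`,
so `X_j < a k * Z` becomes easier (`tailDependent_studentized`).

For part (ii), the density of the absolute values of `X` is, up to a constant, a sum over signs,
that is, an Ising partition function with couplings `-(Q i j / 2) * (x i * x j)`, where `Q = S⁻¹`.
The sign condition makes this model ferromagnetic after a gauge change, and Griffiths' inequality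
with duplicated variables gives log-supermodularity (`foldedKernel_mul_le`). The four functions
theorem passes it to marginals, whence the conditional monotonicity
(`tailDependent_abs_studentized`). -/

noncomputable section

namespace Simes

/-! ### Order statistics expressed by counting. -/

section OrderStatistics

variable {n : ℕ}

lemma orderStat_monotone (x : Fin n → ℝ) : Monotone (orderStat x) := Tuple.monotone_sort x

lemma card_filter_orderStat (x : Fin n → ℝ) (p : ℝ → Prop) [DecidablePred p] :
    (Finset.univ.filter fun j => p (orderStat x j)).card =
      (Finset.univ.filter fun j => p (x j)).card := by
  refine Finset.card_bij (fun j _ => Tuple.sort x j) ?_ ?_ ?_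
  · intro j hj
    exact Finset.mem_filter.mpr ⟨Finset.mem_univ _, (Finset.mem_filter.mp hj).2⟩
  · intro i _ j _ h
    exact (Tuple.sort x).injective h
  · intro j hj
    refine ⟨(Tuple.sort x).symm j, Finset.mem_filter.mpr ⟨Finset.mem_univ _, ?_⟩, by simp⟩
    rw [orderStat, Function.comp_apply, Equiv.apply_symm_apply]
    exact (Finset.mem_filter.mp hj).2

lemma le_orderStat_iff (x : Fin n → ℝ) (c : ℝ) (k : Fin n) :
    c ≤ orderStat x k ↔ (Finset.univ.filter fun j => x j < c).card ≤ (k : ℕ) := by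
  rw [← card_filter_orderStat x (fun y => y < c)]
  constructor
  · intro h
    calc _ ≤ (Finset.Iio k).card := by
          refine Finset.card_le_card fun j hj => ?_
          simp only [Finset.mem_filter, Finset.mem_univ, true_and] at hj
          rw [Finset.mem_Iio]
          by_contra hkj
          exact absurd (orderStat_monotone x (not_lt.mp hkj)) (not_le.mpr (hj.trans_le h))
      _ = k := by simp
  · intro h
    by_contra hc
    have : (Finset.Iic k).card ≤ (Finset.univ.filter fun j => orderStat x j < c).card := by
      refine Finset.card_le_card fun j hj => ?_
      simp only [Finset.mem_filter, Finset.mem_univ, true_and]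
      exact (orderStat_monotone x (Finset.mem_Iic.mp hj)).trans_lt (not_le.mp hc)
    simp at this
    omega

lemma orderStat_le_iff (x : Fin n → ℝ) (c : ℝ) (k : Fin n) :
    orderStat x k ≤ c ↔ (Finset.univ.filter fun j => c < x j).card ≤ (k.rev : ℕ) := by
  rw [← card_filter_orderStat x (fun y => c < y)]
  constructor
  · intro h
    calc _ ≤ (Finset.Ioi k).card := by
          refine Finset.card_le_card fun j hj => ?_
          simp only [Finset.mem_filter, Finset.mem_univ, true_and] at hj
          rw [Finset.mem_Ioi]
          by_contra hkj
          exact absurd (orderStat_monotone x (not_lt.mp hkj)) (not_le.mpr (h.trans_lt hj))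
      _ = k.rev := by simp [Fin.val_rev]; omega
  · intro h
    by_contra hc
    have : (Finset.Ici k).card ≤ (Finset.univ.filter fun j => c < orderStat x j).card := by
      refine Finset.card_le_card fun j hj => ?_
      simp only [Finset.mem_filter, Finset.mem_univ, true_and]
      exact (not_le.mp hc).trans_le (orderStat_monotone x (Finset.mem_Ici.mp hj))
    simp [Fin.val_rev] at this h
    omega

end OrderStatistics

/-! ### The Simes inequality from positive dependence. -/

section StepUp

variable {W : Type*} {n : ℕ}

/-- At some level `k ≥ r`, at least `k` of the variables other than the `i`-th one lie below
their threshold. -/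
def tailEvent (Y : Fin n → W → ℝ) (a : Fin n → ℝ) (i : Fin n) (r : ℕ) : Set W :=
  {w | ∃ k : Fin n, r ≤ k ∧
    (k : ℕ) ≤ (Finset.univ.filter fun j => j ≠ i ∧ Y j w < a k).card}

lemma tailEvent_antitone (Y : Fin n → W → ℝ) (a : Fin n → ℝ) (i : Fin n) :
    Antitone (tailEvent Y a i) := by
  rintro r s hrs w ⟨k, hk, h⟩
  exact ⟨k, hrs.trans hk, h⟩

lemma measurableSet_count_le [MeasurableSpace W] {Y : Fin n → W → ℝ} (hY : ∀ i, Measurable (Y i))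
    (p : Fin n → Prop) [DecidablePred p] (c : ℝ) (m : ℕ) :
    MeasurableSet {w | m ≤ (Finset.univ.filter fun j => p j ∧ Y j w < c).card} := by
  have : Measurable fun w => (Finset.univ.filter fun j => p j ∧ Y j w < c).card := by
    simp_rw [Finset.card_filter]
    refine Finset.measurable_sum _ fun j _ => Measurable.ite ?_ measurable_const measurable_const
    exact (MeasurableSet.const _).inter (measurableSet_lt (hY j) measurable_const)
  exact measurableSet_le measurable_const this

lemma measurableSet_tailEvent [MeasurableSpace W] {Y : Fin n → W → ℝ}
    (hY : ∀ i, Measurable (Y i)) (a : Fin n → ℝ) (i : Fin n) (r : ℕ) :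
    MeasurableSet (tailEvent Y a i r) := by
  have : tailEvent Y a i r = ⋃ k : Fin n, {w | r ≤ (k : ℕ)} ∩
      {w | (k : ℕ) ≤ (Finset.univ.filter fun j => j ≠ i ∧ Y j w < a k).card} := by
    ext w; simp [tailEvent]
  rw [this]
  exact MeasurableSet.iUnion fun k =>
    (MeasurableSet.const _).inter (measurableSet_count_le hY _ _ _)

open Classical in
/-- The step-up procedure decomposed according to the number of rejections. -/
lemma exists_mem_tailEvent_diff {Y : Fin n → W → ℝ} {a : Fin n → ℝ} (ha : Monotone a) {w : W}
    (hw : ∃ k : Fin n, (k : ℕ) + 1 ≤ (Finset.univ.filter fun j => Y j w < a k).card) :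
    ∃ k : Fin n, (k : ℕ) + 1 ≤ (Finset.univ.filter fun i => Y i w < a k ∧
      w ∈ tailEvent Y a i k \ tailEvent Y a i (k + 1)).card := by
  set B := Finset.univ.filter fun k : Fin n =>
    (k : ℕ) + 1 ≤ (Finset.univ.filter fun j => Y j w < a k).card with hB
  have hBne : B.Nonempty := hw.imp fun k hk => by simpa [hB] using hk
  obtain ⟨k, hkB, hmax⟩ := B.exists_max_image id hBne
  refine ⟨k, ?_⟩
  have hk : (k : ℕ) + 1 ≤ (Finset.univ.filter fun j => Y j w < a k).card := by
    simpa [hB] using hkB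
  refine hk.trans (Finset.card_le_card fun i hi => ?_)
  have hi' : Y i w < a k := by simpa using hi
  -- Index `i` is itself counted at every threshold from `k` on, so leaving it out lowers the count
  -- by exactly one.
  have count (m : Fin n) (hm : k ≤ m) :
      (Finset.univ.filter fun j => j ≠ i ∧ Y j w < a m).card + 1 =
        (Finset.univ.filter fun j => Y j w < a m).card := by
    have : (Finset.univ.filter fun j => j ≠ i ∧ Y j w < a m) =
        (Finset.univ.filter fun j => Y j w < a m).erase i := by
      ext j; simp
    rw [this, Finset.card_erase_add_one]
    simpa using hi'.trans_le (ha hm)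
  simp only [Finset.mem_filter, Finset.mem_univ, true_and]
  refine ⟨hi', ⟨k, le_rfl, ?_⟩, ?_⟩
  · have := count k le_rfl
    omega
  -- Membership at level `k + 1` would give a larger level `m` with at least `m + 1` entries below
  -- its threshold, against the maximality of `k`.
  · rintro ⟨m, hm, h⟩
    have hkm : k ≤ m := Fin.le_def.mpr (by omega)
    have hmB : m ∈ B := by
      have := count m hkm
      simp only [hB, Finset.mem_filter, Finset.mem_univ, true_and]
      omega
    have := Fin.le_def.mp (hmax m hmB)
    simp at this
    omega

/-- Here `F r` stands for `P(Y_i < a_r)` and `p r s` for the probability of that event together with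
the tail event at level `s`. The induction keeps the partial sum up to `m` below `(F m - p m (m +
1)) / (m + 1)`. To advance, `hratio` says that the conditional probability of missing level `m + 1`
does not decrease when `F m` is replaced by `F (m + 1)`, and `hF` absorbs the change of denominator.
-/
lemma telescoping_bound {n : ℕ} (hn : 0 < n) (F : ℕ → ℝ) (p : ℕ → ℕ → ℝ)
    (hp : ∀ r s, 0 ≤ p r s) (hpF : ∀ r s, p r s ≤ F r)
    (hF : ∀ r, r + 1 < n → F r / (r + 1) ≤ F (r + 1) / (r + 2))
    (hratio : ∀ r, r + 1 < n → p (r + 1) (r + 1) * F r ≤ p r (r + 1) * F (r + 1)) :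
    ∑ r ∈ Finset.range n, (p r r - p r (r + 1)) / (r + 1) ≤ F (n - 1) / n := by
  suffices H : ∀ m, m < n → ∑ r ∈ Finset.range (m + 1), (p r r - p r (r + 1)) / (r + 1) ≤
      (F m - p m (m + 1)) / (m + 1) by
    obtain ⟨m, rfl⟩ : ∃ m, n = m + 1 := ⟨n - 1, by omega⟩
    refine (H m (by omega)).trans ?_
    simp only [Nat.add_sub_cancel, Nat.cast_add, Nat.cast_one]
    have := hp m (m + 1)
    gcongr
    linarith
  intro m
  induction m with
  | zero =>
    intro _
    have := hpF 0 0
    simp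
    linarith
  | succ m ih =>
    intro hm
    rw [Finset.sum_range_succ]
    have h1 := ih (by omega)
    have h2 : (F m - p m (m + 1)) / (m + 1) ≤ (F (m + 1) - p (m + 1) (m + 1)) / (m + 2) := by
      have hFm : 0 ≤ F m := (hp m m).trans (hpF m m)
      have a1 := hp m (m + 1)
      have a2 := hpF m (m + 1)
      have a3 := hpF (m + 1) (m + 1)
      have a4 := hF m hm
      have a5 := hratio m hm
      rcases hFm.eq_or_lt with h0 | h0
      · have : F m - p m (m + 1) ≤ 0 := by linarith
        exact (div_nonpos_of_nonpos_of_nonneg this (by positivity)).trans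
          (div_nonneg (by linarith) (by positivity))
      · rw [div_le_div_iff₀ (by positivity) (by positivity)] at a4 ⊢
        have key : (F m - p m (m + 1)) * (m + 2) * F m ≤
            (F (m + 1) - p (m + 1) (m + 1)) * (m + 1) * F m := by
          nlinarith [mul_le_mul_of_nonneg_right a4 (sub_nonneg.mpr a2),
            mul_le_mul_of_nonneg_right a5 (by positivity : (0 : ℝ) ≤ (m : ℝ) + 1)]
        exact le_of_mul_le_mul_right key h0
    push_cast
    rw [show (m : ℝ) + 1 + 1 = m + 2 by ring]
    have h3 : (F (m + 1) - p (m + 1) (m + 1)) / ((m : ℝ) + 2) +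
        (p (m + 1) (m + 1) - p (m + 1) (m + 1 + 1)) / (m + 2) =
        (F (m + 1) - p (m + 1) (m + 1 + 1)) / (m + 2) := by ring
    linarith

variable [MeasurableSpace W]

/-- Positive regression dependence, in the weak form needed for the Simes inequality: the
conditional probability of each `tailEvent` given `Y i < t` decreases in `t`. -/
def TailDependent (ρ : Measure W) (Y : Fin n → W → ℝ) (a : Fin n → ℝ) : Prop :=
  ∀ (i : Fin n) (r : ℕ) (s t : ℝ), s ≤ t → (∃ j, t ≤ a j) →
    ρ (tailEvent Y a i r ∩ {w | Y i w < t}) * ρ {w | Y i w < s} ≤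
      ρ (tailEvent Y a i r ∩ {w | Y i w < s}) * ρ {w | Y i w < t}

lemma simes_of_tailDependent (hn : 0 < n) (ρ : Measure W) [IsProbabilityMeasure ρ]
    {Y : Fin n → W → ℝ} (hY : ∀ i, Measurable (Y i)) {a : Fin n → ℝ} (ha : Monotone a)
    (hF : ∀ i, Monotone fun j : Fin n => ((j : ℝ) + 1)⁻¹ * ρ.real {w | Y i w < a j})
    (hdep : TailDependent ρ Y a) :
    1 - (1 / (n : ℝ)) * ∑ i, ρ.real {w | Y i w < a (lastIdx hn)} ≤
      ρ.real {w | ∀ k : Fin n, (Finset.univ.filter fun j => Y j w < a k).card ≤ (k : ℕ)} := by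
  classical
  -- Clamping indexes the thresholds by naturals for the telescoping sum; only the values at `r < n`
  -- are used in it.
  set A : ℕ → Fin n := fun r => ⟨min r (n - 1), by omega⟩ with hA
  have hAk (k : Fin n) : A k = k := by
    ext; simp [hA]; omega
  have hAlast : A (n - 1) = lastIdx hn := by ext; simp [hA, lastIdx]
  have hlt (i : Fin n) (t : ℝ) : MeasurableSet {w | Y i w < t} :=
    measurableSet_lt (hY i) measurable_const
  set D : Fin n → ℕ → Set W := fun i r =>
    {w | Y i w < a (A r)} ∩ (tailEvent Y a i r \ tailEvent Y a i (r + 1)) with hD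
  have hDm (i r) : MeasurableSet (D i r) :=
    (hlt i _).inter ((measurableSet_tailEvent hY a i r).diff (measurableSet_tailEvent hY a i _))
  set bad : Set W := {w | ∃ k : Fin n, (k : ℕ) + 1 ≤
    (Finset.univ.filter fun j => Y j w < a k).card} with hbad
  have hbadm : MeasurableSet bad := by
    have : bad = ⋃ k : Fin n, {w | (k : ℕ) + 1 ≤
        (Finset.univ.filter fun j => True ∧ Y j w < a k).card} := by
      ext w; simp [hbad]
    rw [this]
    exact MeasurableSet.iUnion fun k => measurableSet_count_le hY (fun _ => True) _ _
  have hgood : {w | ∀ k : Fin n, (Finset.univ.filter fun j => Y j w < a k).card ≤ (k : ℕ)} =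
      badᶜ := by
    ext w; simp [hbad]
  rw [hgood, probReal_compl_eq_one_sub hbadm]
  -- On the bad event some `k` has at least `k + 1` indices `i` with `w ∈ D i k`, each of weight `1
  -- / (k + 1)`, so that level alone contributes at least one.
  have pointwise (w : W) : bad.indicator (1 : W → ℝ) w ≤
      ∑ i, ∑ r ∈ Finset.range n, ((r : ℝ) + 1)⁻¹ * (D i r).indicator (1 : W → ℝ) w := by
    by_cases hw : w ∈ bad
    · obtain ⟨k, hk⟩ := exists_mem_tailEvent_diff ha hw
      rw [Set.indicator_of_mem hw, Finset.sum_comm]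
      have hnn (r : ℕ) (i : Fin n) : 0 ≤ ((r : ℝ) + 1)⁻¹ * (D i r).indicator (1 : W → ℝ) w :=
        mul_nonneg (by positivity) (Set.indicator_nonneg (fun _ _ => zero_le_one) _)
      refine le_trans ?_ (Finset.single_le_sum (f := fun r : ℕ =>
        ∑ i, ((r : ℝ) + 1)⁻¹ * (D i r).indicator (1 : W → ℝ) w)
        (fun r _ => Finset.sum_nonneg fun i _ => hnn r i) (Finset.mem_range.mpr k.2))
      rw [← Finset.mul_sum]
      have : ∑ i, (D i k).indicator (1 : W → ℝ) w =
          ((Finset.univ.filter fun i => Y i w < a k ∧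
            w ∈ tailEvent Y a i k \ tailEvent Y a i (k + 1)).card : ℝ) := by
        rw [Finset.card_filter]
        push_cast
        refine Finset.sum_congr rfl fun i _ => ?_
        simp only [Set.indicator_apply, hD, hAk, Set.mem_inter_iff, Set.mem_ofPred_eq, Pi.one_apply]
      rw [this, inv_mul_eq_div, Pi.one_apply, le_div_iff₀ (by positivity), one_mul]
      exact_mod_cast hk
    · rw [Set.indicator_of_notMem hw]
      exact Finset.sum_nonneg fun i _ => Finset.sum_nonneg fun r _ =>
        mul_nonneg (by positivity) (Set.indicator_nonneg (fun _ _ => zero_le_one) _)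
  have hint (s : Set W) (hs : MeasurableSet s) : Integrable (s.indicator (1 : W → ℝ)) ρ :=
    (integrable_const (1 : ℝ)).indicator hs
  have hle : ρ.real bad ≤ ∑ i, ∑ r ∈ Finset.range n, ((r : ℝ) + 1)⁻¹ * ρ.real (D i r) := by
    have := integral_mono (μ := ρ) (hint bad hbadm)
      (integrable_finsetSum _ fun i _ => integrable_finsetSum _ fun r _ =>
        (hint _ (hDm i r)).const_mul _) pointwise
    rw [integral_indicator_one hbadm, integral_finsetSum _ fun i _ =>
      integrable_finsetSum _ fun r _ => (hint _ (hDm i r)).const_mul _] at this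
    refine this.trans_eq (Finset.sum_congr rfl fun i _ => ?_)
    rw [integral_finsetSum _ fun r _ => (hint _ (hDm i r)).const_mul _]
    refine Finset.sum_congr rfl fun r _ => ?_
    rw [integral_const_mul, integral_indicator_one (hDm i r)]
  have hi (i : Fin n) : ∑ r ∈ Finset.range n, ((r : ℝ) + 1)⁻¹ * ρ.real (D i r) ≤
      ρ.real {w | Y i w < a (lastIdx hn)} / n := by
    set p : ℕ → ℕ → ℝ := fun r s => ρ.real (tailEvent Y a i s ∩ {w | Y i w < a (A r)}) with hp
    have hDp (r : ℕ) : ρ.real (D i r) = p r r - p r (r + 1) := by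
      have hset : D i r = (tailEvent Y a i r ∩ {w | Y i w < a (A r)}) \
          (tailEvent Y a i (r + 1) ∩ {w | Y i w < a (A r)}) := by
        ext w
        simp only [hD, Set.mem_inter_iff, Set.mem_sdiff]
        tauto
      rw [hset, measureReal_sdiff (Set.inter_subset_inter_left _
        (tailEvent_antitone Y a i (Nat.le_succ r)))
        ((measurableSet_tailEvent hY a i _).inter (hlt i _))]
    have := telescoping_bound hn (fun r => ρ.real {w | Y i w < a (A r)}) p
      (fun r s => measureReal_nonneg) (fun r s => measureReal_mono Set.inter_subset_right)
      (fun r hr => by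
        have := hF i (a := A r) (b := A (r + 1)) (Fin.le_def.mpr (by simp [hA]))
        have e1 : ((A r : ℕ) : ℝ) = r := by simp [hA]; omega
        have e2 : ((A (r + 1) : ℕ) : ℝ) = r + 1 := by
          have : (A (r + 1) : ℕ) = r + 1 := by simp [hA]; omega
          rw [this]; push_cast; ring
        simp only [e1, e2, inv_mul_eq_div] at this
        rwa [show (r : ℝ) + 2 = r + 1 + 1 by ring])
      (fun r hr => by
        have := hdep i (r + 1) (a (A r)) (a (A (r + 1)))
          (ha (Fin.le_def.mpr (by simp [hA]))) ⟨_, le_rfl⟩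
        have := ENNReal.toReal_mono (by finiteness) this
        simpa [hp, measureReal_def, ENNReal.toReal_mul] using this)
    rw [hAlast] at this
    refine le_trans (le_of_eq (Finset.sum_congr rfl fun r _ => ?_)) this
    rw [hDp, inv_mul_eq_div]
  have := hle.trans (Finset.sum_le_sum fun i _ => hi i)
  rw [← Finset.sum_div] at this
  rw [one_div_mul_eq_div]
  linarith

end StepUp

/-! ### Passage to cdfs and order statistics, and transfer to the joint law. -/

section Inequalities

variable {W : Type*} [MeasurableSpace W] {n : ℕ}

lemma marginalCDF_eq (ρ : Measure W) [IsProbabilityMeasure ρ] {Y : Fin n → W → ℝ}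
    (hY : ∀ i, Measurable (Y i)) (i : Fin n) (t : ℝ) :
    marginalCDF ρ Y i t = ρ.real {w | Y i w ≤ t} := by
  have := Measure.isProbabilityMeasure_map (μ := ρ) (hY i).aemeasurable
  rw [marginalCDF, cdf_eq_real, map_measureReal_apply (hY i) measurableSet_Iic]
  rfl

lemma measureReal_le_eq_lt {ρ : Measure W} {y : W → ℝ} {t : ℝ} (h : ρ {w | y w = t} = 0) :
    ρ.real {w | y w ≤ t} = ρ.real {w | y w < t} := by
  refine measureReal_congr ?_
  have : ∀ᵐ w ∂ρ, y w ≠ t := measure_eq_zero_iff_ae_notMem.mp h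
  filter_upwards [this] with w hw
  exact propext ⟨fun h => lt_of_le_of_ne h hw, fun h => le_of_lt h⟩

/-- The absence of atoms replaces the cdf by the probability of a strict inequality, which is what
the counting argument uses. -/
lemma lowerInequality_of_tailDependent (hn : 0 < n) (ρ : Measure W) [IsProbabilityMeasure ρ]
    {Y : Fin n → W → ℝ} (hY : ∀ i, Measurable (Y i)) (hatom : ∀ i t, ρ {w | Y i w = t} = 0)
    {a : Fin n → ℝ} (ha : LowerAdmissible ρ Y a) (hdep : TailDependent ρ Y a) :
    LowerInequality hn ρ Y a := by
  have hc (i : Fin n) (t : ℝ) : marginalCDF ρ Y i t = ρ.real {w | Y i w < t} := by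
    rw [marginalCDF_eq ρ hY, measureReal_le_eq_lt (hatom i t)]
  obtain ⟨ham, hF⟩ := ha
  simp only [hc] at hF
  have := simes_of_tailDependent hn ρ hY ham hF hdep
  simpa only [LowerInequality, hc, le_orderStat_iff] using this

/-- Negation turns `1 - F_i(t)` into the probability that `-Y_i < -t`, already a strict inequality,
so atoms do no harm here. -/
lemma upperInequality_of_tailDependent (hn : 0 < n) (ρ : Measure W) [IsProbabilityMeasure ρ]
    {Y : Fin n → W → ℝ} (hY : ∀ i, Measurable (Y i))
    {b : Fin n → ℝ} (hb : UpperAdmissible ρ Y b)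
    (hdep : TailDependent ρ (fun i w => -Y i w) (fun j => -b j.rev)) :
    UpperInequality hn ρ Y b := by
  have hc (i : Fin n) (t : ℝ) : 1 - marginalCDF ρ Y i t = ρ.real {w | -Y i w < -t} := by
    rw [marginalCDF_eq ρ hY, ← probReal_compl_eq_one_sub (measurableSet_le (hY i) measurable_const)]
    congr 1
    ext w; simp
  obtain ⟨hbm, hF⟩ := hb
  simp only [hc] at hF
  have := simes_of_tailDependent hn ρ (Y := fun i w => -Y i w) (fun i => (hY i).neg)
    (a := fun j => -b j.rev)
    (fun j k hjk => neg_le_neg (hbm (Fin.rev_le_rev.mpr hjk))) hF hdep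
  have hlast : (lastIdx hn).rev = firstIdx hn := by
    ext; simp [lastIdx, firstIdx, Fin.val_rev]; omega
  simp only [hlast, ← hc] at this
  rw [UpperInequality]
  have hset : {w | ∀ k : Fin n, (Finset.univ.filter fun j => -Y j w < -b k.rev).card ≤ (k : ℕ)} =
      {w | ∀ j, orderStat (fun i => Y i w) j ≤ b j} := by
    ext w
    simp only [Set.mem_ofPred_eq, orderStat_le_iff, neg_lt_neg_iff]
    exact ⟨fun h j => by simpa using h j.rev, fun h k => by simpa using h k.rev⟩
  rw [hset] at this
  refine le_trans (le_of_eq ?_) this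
  have : (n : ℝ) ≠ 0 := by positivity
  rw [Finset.sum_sub_distrib]
  simp
  field_simp
  ring

variable {Ω : Type*} [MeasurableSpace Ω] {P : Measure Ω} {V : Ω → W} {Y : Fin n → W → ℝ}

lemma marginalCDF_comp (hV : AEMeasurable V P) (hY : ∀ i, Measurable (Y i)) :
    marginalCDF P (fun i ω => Y i (V ω)) = marginalCDF (P.map V) Y := by
  ext i x
  rw [marginalCDF, marginalCDF, AEMeasurable.map_map_of_aemeasurable (hY i).aemeasurable hV]
  rfl

lemma measurable_orderStat (j : Fin n) : Measurable fun x : Fin n → ℝ => orderStat x j := by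
  refine measurable_of_Ici fun c => ?_
  have : (fun x : Fin n → ℝ => orderStat x j) ⁻¹' Set.Ici c =
      {x | (j : ℕ) + 1 ≤ (Finset.univ.filter fun k => True ∧ x k < c).card}ᶜ := by
    ext x; simp [le_orderStat_iff]
  rw [this]
  exact (measurableSet_count_le (Y := fun k (x : Fin n → ℝ) => x k) (fun i => measurable_pi_apply i)
    (fun _ => True) _ _).compl

lemma lowerInequality_comp (hn : 0 < n) (hV : AEMeasurable V P) (hY : ∀ i, Measurable (Y i))
    {a : Fin n → ℝ} (h : LowerInequality hn (P.map V) Y a) :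
    LowerInequality hn P (fun i ω => Y i (V ω)) a := by
  rw [LowerInequality, marginalCDF_comp hV hY]
  refine h.trans_eq ?_
  rw [measureReal_def, Measure.map_apply_of_aemeasurable hV]
  · rfl
  · rw [Set.ofPred_forall]
    exact MeasurableSet.iInter fun j => measurableSet_le measurable_const
      ((measurable_orderStat j).comp (measurable_pi_lambda _ hY))

lemma upperInequality_comp (hn : 0 < n) (hV : AEMeasurable V P) (hY : ∀ i, Measurable (Y i))
    {b : Fin n → ℝ} (h : UpperInequality hn (P.map V) Y b) :
    UpperInequality hn P (fun i ω => Y i (V ω)) b := by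
  rw [UpperInequality, marginalCDF_comp hV hY]
  refine h.trans_eq ?_
  rw [measureReal_def, Measure.map_apply_of_aemeasurable hV]
  · rfl
  · rw [Set.ofPred_forall]
    exact MeasurableSet.iInter fun j => measurableSet_le
      ((measurable_orderStat j).comp (measurable_pi_lambda _ hY)) measurable_const

lemma lowerAdmissible_comp (hV : AEMeasurable V P) (hY : ∀ i, Measurable (Y i)) {a : Fin n → ℝ} :
    LowerAdmissible P (fun i ω => Y i (V ω)) a ↔ LowerAdmissible (P.map V) Y a := by
  rw [LowerAdmissible, marginalCDF_comp hV hY, LowerAdmissible]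

lemma upperAdmissible_comp (hV : AEMeasurable V P) (hY : ∀ i, Measurable (Y i)) {b : Fin n → ℝ} :
    UpperAdmissible P (fun i ω => Y i (V ω)) b ↔ UpperAdmissible (P.map V) Y b := by
  rw [UpperAdmissible, marginalCDF_comp hV hY, UpperAdmissible]

end Inequalities

end Simes

end

noncomputable section

namespace Simes

/-! ### Independence of the ratio and the radius. -/

section Polar

open Set
open scoped ENNReal

lemma lintegral_eq_mul_lintegral_comp_mul (f : ℝ → ℝ≥0∞) (hf : Measurable f) {c : ℝ}
    (hc : 0 < c) : ∫⁻ x, f x = ENNReal.ofReal c * ∫⁻ x, f (c * x) := by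
  conv_lhs => rw [← Real.smul_map_volume_mul_left hc.ne']
  rw [lintegral_smul_measure, lintegral_map hf (measurable_const_mul c), abs_of_pos hc]
  rfl

lemma setLIntegral_Ioi_eq_mul_comp_mul (f : ℝ → ℝ≥0∞) (hf : Measurable f) {c : ℝ}
    (hc : 0 < c) :
    ∫⁻ x in Ioi 0, f x = ENNReal.ofReal c * ∫⁻ x in Ioi 0, f (c * x) := by
  rw [← lintegral_indicator measurableSet_Ioi, ← lintegral_indicator measurableSet_Ioi,
    lintegral_eq_mul_lintegral_comp_mul _ (hf.indicator measurableSet_Ioi) hc]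
  congr 2
  ext x
  simp [indicator, hc]

/-- The unnormalized law of `X ^ 2 + ν * Z ^ 2`, for `X` standard Gaussian and `Z` an independent
scaled `χ_ν` variable. -/
def radialMeasure (ν : ℝ) : Measure ℝ :=
  (volume.restrict (Ioi 0)).withDensity
    fun w => ENNReal.ofReal (w ^ ((ν - 1) / 2) * Real.exp (-(w / 2)))

/-- The law of `X / Z`, up to a constant. -/
def angularMeasure (ν : ℝ) : Measure ℝ :=
  volume.withDensity fun y => ENNReal.ofReal
    ((1 / 2) ^ (ν / 2) / Real.Gamma (ν / 2) / √ν / √(2 * Real.pi) *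
      (ν / (ν + y ^ 2)) ^ ((ν + 1) / 2))

instance (ν : ℝ) : SFinite (radialMeasure ν) := by unfold radialMeasure; infer_instance
instance (ν : ℝ) : SFinite (angularMeasure ν) := by unfold angularMeasure; infer_instance
instance (ν : ℝ) : NullSingletonClass (angularMeasure ν) := by unfold angularMeasure; infer_instance

/-- The Jacobian computation for `ν z ^ 2 = ν / (ν + y ^ 2) * w` and `x = z * y`: the two exponents
add up to `-(w / 2)`, and the powers split into a function of `y` times a function of `w`. -/
lemma polar_density {ν : ℝ} (hν : 0 < ν) (y : ℝ) {w : ℝ} (hw : 0 < w) :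
    ν / (ν + y ^ 2) * (gammaPDFReal (ν / 2) (1 / 2) (ν / (ν + y ^ 2) * w) *
      (√(w / (ν + y ^ 2)) * gaussianPDFReal 0 1 (√(w / (ν + y ^ 2)) * y))) =
    (1 / 2) ^ (ν / 2) / Real.Gamma (ν / 2) / √ν / √(2 * Real.pi) *
      (ν / (ν + y ^ 2)) ^ ((ν + 1) / 2) * (w ^ ((ν - 1) / 2) * Real.exp (-(w / 2))) := by
  have hd : 0 < ν + y ^ 2 := by positivity
  set c := ν / (ν + y ^ 2) with hc
  have hc0 : 0 < c := by positivity
  have hs : √(w / (ν + y ^ 2)) = (c * w) ^ (1 / 2 : ℝ) / √ν := by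
    rw [← Real.sqrt_eq_rpow, ← Real.sqrt_div (by positivity)]
    congr 1
    rw [hc]
    field_simp
  have hexp : Real.exp (-(1 / 2 * (c * w))) *
      Real.exp (-(√(w / (ν + y ^ 2)) * y - 0) ^ 2 / (2 * (1 : NNReal))) = Real.exp (-(w / 2)) := by
    rw [← Real.exp_add]
    congr 1
    rw [sub_zero, mul_pow, Real.sq_sqrt (by positivity), hc]
    push_cast
    field_simp
    ring
  have hpow : c * ((c * w) ^ (ν / 2 - 1) * (c * w) ^ (1 / 2 : ℝ)) =
      c ^ ((ν + 1) / 2) * w ^ ((ν - 1) / 2) := by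
    rw [← Real.rpow_add (by positivity), show ν / 2 - 1 + 1 / 2 = (ν - 1) / 2 by ring,
      Real.mul_rpow hc0.le hw.le, ← mul_assoc, show (ν + 1) / 2 = 1 + (ν - 1) / 2 by ring,
      Real.rpow_add hc0, Real.rpow_one]
  rw [gammaPDFReal, if_pos (by positivity), gaussianPDFReal, ← hexp]
  simp only [NNReal.coe_one, mul_one] at *
  calc _ = (1 / 2) ^ (ν / 2) / Real.Gamma (ν / 2) / √(2 * Real.pi) *
        (c * ((c * w) ^ (ν / 2 - 1) * √(w / (ν + y ^ 2)))) *
        (Real.exp (-(1 / 2 * (c * w))) *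
          Real.exp (-(√(w / (ν + y ^ 2)) * y - 0) ^ 2 / 2)) := by ring
    _ = (1 / 2) ^ (ν / 2) / Real.Gamma (ν / 2) / √(2 * Real.pi) *
        (c * ((c * w) ^ (ν / 2 - 1) * (c * w) ^ (1 / 2 : ℝ))) / √ν *
        (Real.exp (-(1 / 2 * (c * w))) *
          Real.exp (-(√(w / (ν + y ^ 2)) * y - 0) ^ 2 / 2)) := by
        conv_lhs => enter [1, 2, 2, 2]; rw [hs]
        ring
    _ = _ := by rw [hpow]; ring

lemma measurable_scaledChi_map (ν : ℝ) : Measurable fun y : ℝ => √y / √ν := by fun_prop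

instance (ν : ℝ) : SFinite (scaledChiMeasure ν) := by
  unfold scaledChiMeasure chiSquaredMeasure gammaMeasure; infer_instance

lemma isProbabilityMeasure_scaledChiMeasure {ν : ℝ} (hν : 0 < ν) :
    IsProbabilityMeasure (scaledChiMeasure ν) := by
  have : IsProbabilityMeasure (chiSquaredMeasure ν) :=
    isProbabilityMeasure_gammaMeasure (a := ν / 2) (r := 1 / 2) (by positivity)
    (by positivity)
  exact Measure.isProbabilityMeasure_map (measurable_scaledChi_map ν).aemeasurable

lemma measurable_gammaPDF (a r : ℝ) : Measurable (gammaPDF a r) :=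
  (measurable_gammaPDFReal a r).ennreal_ofReal

lemma lintegral_scaledChiMeasure (ν : ℝ) {f : ℝ → ℝ≥0∞} (hf : Measurable f) :
    ∫⁻ z, f z ∂scaledChiMeasure ν =
      ∫⁻ v in Ioi 0, gammaPDF (ν / 2) (1 / 2) v * f (√v / √ν) := by
  rw [scaledChiMeasure, lintegral_map hf (measurable_scaledChi_map ν), chiSquaredMeasure,
    gammaMeasure, lintegral_withDensity_eq_lintegral_mul _ (measurable_gammaPDF _ _)
      (g := fun v => f (√v / √ν)) (hf.comp (measurable_scaledChi_map ν)), ← lintegral_indicator measurableSet_Ioi]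
  refine lintegral_congr_ae ?_
  have : ∀ᵐ v : ℝ, v ≠ 0 := by simp [ae_iff]
  filter_upwards [this] with v hv
  by_cases h : 0 < v
  · simp [indicator, h]
  · have : v < 0 := lt_of_le_of_ne (not_lt.mp h) hv
    simp [indicator, h, gammaPDF_of_neg this]

lemma ae_pos_scaledChiMeasure {ν : ℝ} (hν : 0 < ν) : ∀ᵐ z ∂scaledChiMeasure ν, 0 < z := by
  have : scaledChiMeasure ν (Iic 0) = 0 := by
    rw [← lintegral_indicator_one measurableSet_Iic, lintegral_scaledChiMeasure ν
      (measurable_one.indicator measurableSet_Iic)]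
    rw [setLIntegral_congr_fun (g := fun _ => 0) measurableSet_Ioi]
    · simp
    · intro v hv
      have : 0 < √v / √ν := div_pos (Real.sqrt_pos.mpr hv) (Real.sqrt_pos.mpr hν)
      simp [indicator, not_le.mpr this]
  filter_upwards [measure_eq_zero_iff_ae_notMem.mp this] with z hz
  simpa using hz

/-- Polar decomposition: `X / Z` is independent of `X ^ 2 + ν * Z ^ 2`. -/
lemma lintegral_polar {ν : ℝ} (hν : 0 < ν) {G : ℝ × ℝ → ℝ≥0∞} (hG : Measurable G) :
    ∫⁻ z, ∫⁻ x, G (x, z) ∂gaussianReal 0 1 ∂scaledChiMeasure ν =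
      ∫⁻ y, ∫⁻ w, G (√(w / (ν + y ^ 2)) * y, √(w / (ν + y ^ 2)))
        ∂radialMeasure ν ∂angularMeasure ν := by
  have hm1 : Measurable fun p : ℝ × ℝ => gammaPDF (ν / 2) (1 / 2) p.1 :=
    (measurable_gammaPDF _ _).comp measurable_fst
  have hm2 : Measurable fun p : ℝ × ℝ => gaussianPDF 0 1 ((√p.1 / √ν) * p.2) :=
    (measurable_gaussianPDF 0 1).comp (by fun_prop)
  have hm3 : Measurable fun p : ℝ × ℝ => G ((√p.1 / √ν) * p.2, √p.1 / √ν) :=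
    hG.comp (by fun_prop)
  have hm4 : Measurable fun p : ℝ × ℝ => gammaPDF (ν / 2) (1 / 2) p.1 *
      (ENNReal.ofReal (√p.1 / √ν) * (gaussianPDF 0 1 ((√p.1 / √ν) * p.2) *
        G ((√p.1 / √ν) * p.2, √p.1 / √ν))) := by fun_prop
  calc _ = ∫⁻ v in Ioi 0, gammaPDF (ν / 2) (1 / 2) v *
        ∫⁻ x, G (x, √v / √ν) ∂gaussianReal 0 1 :=
      lintegral_scaledChiMeasure ν (hG.lintegral_prod_left' (μ := gaussianReal 0 1))
    _ = ∫⁻ v in Ioi 0, ∫⁻ y, gammaPDF (ν / 2) (1 / 2) v *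
        (ENNReal.ofReal (√v / √ν) * (gaussianPDF 0 1 ((√v / √ν) * y) *
          G ((√v / √ν) * y, √v / √ν))) := by
      -- Substitution `x = z * y` at fixed `z = √v / √ν`.
      refine setLIntegral_congr_fun measurableSet_Ioi fun v hv => ?_
      have hs : 0 < √v / √ν := div_pos (Real.sqrt_pos.mpr hv) (Real.sqrt_pos.mpr hν)
      have hGs : Measurable fun x => G (x, √v / √ν) := hG.comp measurable_prodMk_right
      have hmul := (measurable_gaussianPDF 0 1).mul hGs
      have hmul' : Measurable fun x => (gaussianPDF 0 1 * fun x => G (x, √v / √ν)) (√v / √ν * x) :=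
        hmul.comp (measurable_const_mul (√v / √ν))
      rw [gaussianReal_of_var_ne_zero 0 one_ne_zero, lintegral_withDensity_eq_lintegral_mul _
        (measurable_gaussianPDF 0 1) hGs, lintegral_eq_mul_lintegral_comp_mul _ hmul hs,
        ← lintegral_const_mul _ hmul', ← lintegral_const_mul _ (hmul'.const_mul _)]
      rfl
    _ = ∫⁻ y, ∫⁻ v in Ioi 0, gammaPDF (ν / 2) (1 / 2) v *
        (ENNReal.ofReal (√v / √ν) * (gaussianPDF 0 1 ((√v / √ν) * y) *
          G ((√v / √ν) * y, √v / √ν))) := lintegral_lintegral_swap hm4.aemeasurable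
    _ = ∫⁻ y, ENNReal.ofReal ((1 / 2) ^ (ν / 2) / Real.Gamma (ν / 2) / √ν / √(2 * Real.pi) *
          (ν / (ν + y ^ 2)) ^ ((ν + 1) / 2)) *
        ∫⁻ w, G (√(w / (ν + y ^ 2)) * y, √(w / (ν + y ^ 2))) ∂radialMeasure ν := by
      refine lintegral_congr fun y => ?_
      have hd : 0 < ν + y ^ 2 := by positivity
      have hc : 0 < ν / (ν + y ^ 2) := by positivity
      have hm5 : Measurable fun v : ℝ => gammaPDF (ν / 2) (1 / 2) v *
          (ENNReal.ofReal (√v / √ν) * (gaussianPDF 0 1 ((√v / √ν) * y) *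
            G ((√v / √ν) * y, √v / √ν))) := hm4.comp measurable_prodMk_right
      have hm7 : Measurable fun w : ℝ => gammaPDF (ν / 2) (1 / 2) (ν / (ν + y ^ 2) * w) *
          (ENNReal.ofReal (√(ν / (ν + y ^ 2) * w) / √ν) *
            (gaussianPDF 0 1 ((√(ν / (ν + y ^ 2) * w) / √ν) * y) *
              G ((√(ν / (ν + y ^ 2) * w) / √ν) * y, √(ν / (ν + y ^ 2) * w) / √ν))) :=
        hm5.comp (measurable_const_mul _)
      have hm6 : Measurable fun w : ℝ =>
          G (√(w / (ν + y ^ 2)) * y, √(w / (ν + y ^ 2))) := hG.comp (by fun_prop)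
      -- Substitution `v = ν / (ν + y ^ 2) * w` at fixed `y`.
      rw [setLIntegral_Ioi_eq_mul_comp_mul _ hm5 hc,
        radialMeasure, lintegral_withDensity_eq_lintegral_mul₀ (by fun_prop)
          hm6.aemeasurable, ← lintegral_const_mul _ hm7,
          ← lintegral_const_mul]
      · refine setLIntegral_congr_fun measurableSet_Ioi fun w hw => ?_
        have hs : √(ν / (ν + y ^ 2) * w) / √ν = √(w / (ν + y ^ 2)) := by
          rw [← Real.sqrt_div (mul_nonneg hc.le (le_of_lt hw))]
          congr 1
          field_simp
        simp only [hs, Pi.mul_apply, gammaPDF, gaussianPDF]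
        have hkey := congrArg ENNReal.ofReal (polar_density hν y hw)
        have hC : 0 ≤ (1 / 2 : ℝ) ^ (ν / 2) / Real.Gamma (ν / 2) / √ν / √(2 * Real.pi) *
            (ν / (ν + y ^ 2)) ^ ((ν + 1) / 2) := by
          have := Real.Gamma_pos_of_pos (half_pos hν)
          positivity
        rw [ENNReal.ofReal_mul hc.le, ENNReal.ofReal_mul (gammaPDFReal_nonneg (half_pos hν)
          one_half_pos _), ENNReal.ofReal_mul (Real.sqrt_nonneg _), ENNReal.ofReal_mul hC] at hkey
        rw [← mul_assoc _ _ (G _), ← mul_assoc _ _ (G _), ← mul_assoc _ _ (G _),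
          ← mul_assoc _ _ (G _), hkey]
      · fun_prop
    _ = _ := by
      rw [angularMeasure, lintegral_withDensity_eq_lintegral_mul₀ (by fun_prop)]
      · rfl
      · refine Measurable.aemeasurable ?_
        exact Measurable.lintegral_prod_right' (f := fun p : ℝ × ℝ =>
          G (√(p.2 / (ν + p.1 ^ 2)) * p.1, √(p.2 / (ν + p.1 ^ 2)))) (hG.comp (by fun_prop))

lemma ae_pos_radialMeasure (ν : ℝ) : ∀ᵐ w ∂radialMeasure ν, 0 < w :=
  (withDensity_absolutelyContinuous _ _).ae_le (ae_restrict_mem measurableSet_Ioi)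

end Polar

/-! ### Conditional monotonicity along the polar arcs. -/

section Ratio

open Set
open scoped ENNReal

/-- With `A = {T < s}` and `B = {s ≤ T < t}`, the common part over `A` cancels. What remains
compares the averages of `φ` on `B` and on `A`, and these are separated by the supremum of `φ` on
`B`. -/
lemma lintegral_ratio_of_antitone {φ : ℝ → ℝ≥0∞} {m : Measure ℝ} (T : ℝ → ℝ)
    (hT : Measurable T) {s t : ℝ} (hst : s ≤ t)
    (hφ : ∀ y y', T y < s → s ≤ T y' → T y' < t → φ y' ≤ φ y) :
    (∫⁻ y in {y | T y < t}, φ y ∂m) * m {y | T y < s} ≤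
      (∫⁻ y in {y | T y < s}, φ y ∂m) * m {y | T y < t} := by
  set A := {y | T y < s}
  set B := {y | s ≤ T y ∧ T y < t}
  have hA : MeasurableSet A := measurableSet_lt hT measurable_const
  have hB : MeasurableSet B :=
    (measurableSet_le measurable_const hT).inter (measurableSet_lt hT measurable_const)
  have hAB : {y | T y < t} = A ∪ B := by
    ext y
    simp only [A, B, mem_ofPred_eq, mem_union]
    constructor
    · intro hy
      rcases lt_or_ge (T y) s with h | h
      · exact Or.inl h
      · exact Or.inr ⟨h, hy⟩
    · rintro (h | h)
      · exact h.trans_le hst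
      · exact h.2
  have hdisj : Disjoint A B := by
    rw [Set.disjoint_left]
    intro y hy hy'
    exact absurd hy'.1 (not_le.mpr hy)
  rw [hAB, lintegral_union hB hdisj, measure_union hdisj hB, add_mul, mul_add]
  refine add_le_add le_rfl ?_
  have h1 : ∫⁻ y in B, φ y ∂m ≤ (⨆ y ∈ B, φ y) * m B := by
    rw [← setLIntegral_const]
    exact setLIntegral_mono' hB fun y hy => le_iSup₂ (f := fun y (_ : y ∈ B) => φ y) y hy
  have h2 : (⨆ y ∈ B, φ y) * m A ≤ ∫⁻ y in A, φ y ∂m := by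
    rw [← setLIntegral_const]
    exact setLIntegral_mono' hA fun y hy => iSup₂_le fun y' hy' => hφ y y' hy hy'.1 hy'.2
  calc _ ≤ (⨆ y ∈ B, φ y) * m B * m A := by gcongr
    _ = (⨆ y ∈ B, φ y) * m A * m B := by ring
    _ ≤ _ := by gcongr

variable {n : ℕ} {ν : ℝ} {μ : Measure (EuclideanSpace ℝ (Fin n))} [SFinite μ]

/-- In polar coordinates `z⁻¹ * x = y`, so the constraint on `T` restricts only the angular variable
and leaves the radial integral free. -/
lemma prod_apply_eq_lintegral_polar (hν : 0 < ν) {T : ℝ → ℝ} (hT : Measurable T) {i : Fin n}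
    {E : Set (EuclideanSpace ℝ (Fin n) × ℝ)} (hE : MeasurableSet E)
    {g : ℝ × ℝ → ℝ≥0∞} (hg : Measurable g)
    (hcond : ∀ z t, 0 < z → μ {x | (x, z) ∈ E ∧ T (z⁻¹ * x i) < t} =
      ∫⁻ x in {x | T (z⁻¹ * x) < t}, g (x, z) ∂gaussianReal 0 1) (t : ℝ) :
    (μ.prod (scaledChiMeasure ν)) (E ∩ {p | T (p.2⁻¹ * p.1 i) < t}) =
      ∫⁻ y in {y | T y < t}, ∫⁻ w, g (√(w / (ν + y ^ 2)) * y, √(w / (ν + y ^ 2)))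
        ∂radialMeasure ν ∂angularMeasure ν := by
  have hTm : MeasurableSet {p : ℝ × ℝ | T (p.2⁻¹ * p.1) < t} :=
    measurableSet_lt (hT.comp (by fun_prop)) measurable_const
  have hTm' : MeasurableSet {p : EuclideanSpace ℝ (Fin n) × ℝ | T (p.2⁻¹ * p.1 i) < t} :=
    measurableSet_lt (hT.comp (by fun_prop)) measurable_const
  have hTy : MeasurableSet {y | T y < t} := measurableSet_lt hT measurable_const
  rw [Measure.prod_apply_symm (hE.inter hTm')]
  calc _ = ∫⁻ z, ∫⁻ x, {p : ℝ × ℝ | T (p.2⁻¹ * p.1) < t}.indicator g (x, z)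
        ∂gaussianReal 0 1 ∂scaledChiMeasure ν := by
        refine lintegral_congr_ae ?_
        filter_upwards [ae_pos_scaledChiMeasure hν] with z hz
        have := hcond z t hz
        have e : (fun x => (x, z)) ⁻¹' (E ∩ {p | T (p.2⁻¹ * p.1 i) < t}) =
          {x | (x, z) ∈ E ∧ T (z⁻¹ * x i) < t} := rfl
        have hz' : MeasurableSet {x : ℝ | T (z⁻¹ * x) < t} :=
          measurableSet_lt (hT.comp (by fun_prop)) measurable_const
        rw [e, this, ← lintegral_indicator hz']
        rfl
    _ = _ := by
      rw [lintegral_polar hν (hg.indicator hTm), ← lintegral_indicator hTy]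
      refine lintegral_congr fun y => ?_
      have hd : 0 < ν + y ^ 2 := by positivity
      have : ∀ᵐ w ∂radialMeasure ν, {p : ℝ × ℝ | T (p.2⁻¹ * p.1) < t}.indicator g
          (√(w / (ν + y ^ 2)) * y, √(w / (ν + y ^ 2))) = {y | T y < t}.indicator
          (fun y => g (√(w / (ν + y ^ 2)) * y, √(w / (ν + y ^ 2)))) y := by
        filter_upwards [ae_pos_radialMeasure ν] with w hw
        have hs : √(w / (ν + y ^ 2)) ≠ 0 := (Real.sqrt_pos.mpr (by positivity)).ne'
        simp only [indicator, mem_ofPred_eq, inv_mul_cancel_left₀ hs]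
      rw [lintegral_congr_ae this]
      by_cases hy : T y < t <;> simp [indicator, hy]

/-- Integrating `g` over the radius gives a function of `y` alone, and `hmono` compares it at two
angles for each fixed radius. -/
lemma ratio_of_conditional (hν : 0 < ν) {T : ℝ → ℝ} (hT : Measurable T) {i : Fin n}
    (hμ : ∀ A : Set ℝ, MeasurableSet A → μ {x | x i ∈ A} = gaussianReal 0 1 A)
    {E : Set (EuclideanSpace ℝ (Fin n) × ℝ)} (hE : MeasurableSet E)
    {g : ℝ × ℝ → ℝ≥0∞} (hg : Measurable g)
    (hcond : ∀ z t, 0 < z → μ {x | (x, z) ∈ E ∧ T (z⁻¹ * x i) < t} =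
      ∫⁻ x in {x | T (z⁻¹ * x) < t}, g (x, z) ∂gaussianReal 0 1)
    {s t : ℝ} (hst : s ≤ t)
    (hmono : ∀ y y' w, T y < s → s ≤ T y' → T y' < t → 0 < w →
      g (√(w / (ν + y' ^ 2)) * y', √(w / (ν + y' ^ 2))) ≤
        g (√(w / (ν + y ^ 2)) * y, √(w / (ν + y ^ 2)))) :
    (μ.prod (scaledChiMeasure ν)) (E ∩ {p | T (p.2⁻¹ * p.1 i) < t}) *
        (μ.prod (scaledChiMeasure ν)) {p | T (p.2⁻¹ * p.1 i) < s} ≤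
      (μ.prod (scaledChiMeasure ν)) (E ∩ {p | T (p.2⁻¹ * p.1 i) < s}) *
        (μ.prod (scaledChiMeasure ν)) {p | T (p.2⁻¹ * p.1 i) < t} := by
  -- The radial measure is not normalized; its total mass enters both sides of the claim as the same
  -- factor.
  have huniv (t : ℝ) : (μ.prod (scaledChiMeasure ν)) {p | T (p.2⁻¹ * p.1 i) < t} =
      radialMeasure ν univ * angularMeasure ν {y | T y < t} := by
    have := prod_apply_eq_lintegral_polar (μ := μ) (i := i) hν hT MeasurableSet.univ
      (g := 1) measurable_one (fun z t _ => by
        simp only [mem_univ, true_and, Pi.one_apply, setLIntegral_one]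
        exact hμ _ (measurableSet_lt (hT.comp (by fun_prop)) measurable_const)) t
    simpa using this
  rw [prod_apply_eq_lintegral_polar hν hT hE hg hcond,
    prod_apply_eq_lintegral_polar hν hT hE hg hcond, huniv, huniv]
  have := lintegral_ratio_of_antitone (m := angularMeasure ν)
    (φ := fun y => ∫⁻ w, g (√(w / (ν + y ^ 2)) * y, √(w / (ν + y ^ 2))) ∂radialMeasure ν)
    T hT hst (fun y y' h1 h2 h3 => by
      refine lintegral_mono_ae ?_
      filter_upwards [ae_pos_radialMeasure ν] with w hw
      exact hmono y y' w h1 h2 h3 hw)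
  calc _ = radialMeasure ν univ * (_ * _) := by ring
    _ ≤ radialMeasure ν univ * (_ * _) := mul_le_mul_right this _
    _ = _ := by ring

lemma prod_ratio_eq_zero (hν : 0 < ν) {i : Fin n}
    (hμ : ∀ A : Set ℝ, MeasurableSet A → μ {x | x i ∈ A} = gaussianReal 0 1 A) (t : ℝ) :
    (μ.prod (scaledChiMeasure ν)) {p | p.2⁻¹ * p.1 i = t} = 0 := by
  have hm : MeasurableSet {p : EuclideanSpace ℝ (Fin n) × ℝ | p.2⁻¹ * p.1 i = t} :=
    measurableSet_eq_fun (by fun_prop) measurable_const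
  rw [Measure.prod_apply_symm hm, lintegral_eq_zero_iff' (by
    exact (measurable_measure_prodMk_right hm).aemeasurable)]
  filter_upwards [ae_pos_scaledChiMeasure hν] with z hz
  have : (fun x : EuclideanSpace ℝ (Fin n) => (x, z)) ⁻¹' {p | p.2⁻¹ * p.1 i = t} =
      {x | x i ∈ ({z * t} : Set ℝ)} := by
    ext x
    simp only [mem_preimage, mem_ofPred_eq, mem_singleton_iff]
    rw [inv_mul_eq_iff_eq_mul₀ hz.ne']
  rw [this, hμ _ (measurableSet_singleton _)]
  have := nullSingletonClass_gaussianReal (μ := 0) (v := 1) one_ne_zero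
  simp

end Ratio

end Simes

end

noncomputable section

namespace Simes

/-! ### Monotonicity of the tail event and of the polar arcs. -/

section Comparison

lemma tailEvent_of_forall {W : Type*} {n : ℕ} {Y : Fin n → W → ℝ} {a : Fin n → ℝ} {i : Fin n}
    {r : ℕ} {w w' : W} (h : ∀ j k, j ≠ i → Y j w' < a k → Y j w < a k)
    (hw : w' ∈ tailEvent Y a i r) : w ∈ tailEvent Y a i r := by
  obtain ⟨k, hk, hcard⟩ := hw
  refine ⟨k, hk, hcard.trans (Finset.card_le_card fun j hj => ?_)⟩
  simp only [Finset.mem_filter, Finset.mem_univ, true_and] at hj ⊢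
  exact ⟨hj.1, h j k hj.1 hj.2⟩

variable {ν : ℝ} {y y' w : ℝ}

/-- Together with the next lemma: on the arc `x ^ 2 + ν z ^ 2 = w`, a steeper ratio trades a smaller
`z` for a larger `|x|`. -/
lemma sqrt_div_le_of_abs_le (hν : 0 < ν) (hw : 0 < w) (h : |y'| ≤ |y|) :
    √(w / (ν + y ^ 2)) ≤ √(w / (ν + y' ^ 2)) := by
  have := sq_le_sq.mpr h
  gcongr

lemma sqrt_div_mul_abs_le (hν : 0 < ν) (hw : 0 < w) (h : |y'| ≤ |y|) :
    √(w / (ν + y' ^ 2)) * |y'| ≤ √(w / (ν + y ^ 2)) * |y| := by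
  rw [← Real.sqrt_sq_eq_abs, ← Real.sqrt_sq_eq_abs, ← Real.sqrt_mul (by positivity),
    ← Real.sqrt_mul (by positivity)]
  have := sq_le_sq.mpr h
  refine Real.sqrt_le_sqrt ?_
  rw [div_mul_eq_mul_div, div_mul_eq_mul_div, div_le_div_iff₀ (by positivity) (by positivity)]
  nlinarith [mul_le_mul_of_nonneg_left this (mul_pos hw hν).le]

end Comparison

/-! ### Positive correlations: regression on one coordinate. -/

section Regression

variable {n : ℕ} {S : Matrix (Fin n) (Fin n) ℝ}

lemma multivariateGaussian_eval (hS : S.PosSemidef) (hdiag : ∀ i, S i i = 1) (i : Fin n)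
    (A : Set ℝ) (hA : MeasurableSet A) :
    multivariateGaussian 0 S {x | x i ∈ A} = gaussianReal 0 1 A := by
  have := (measurePreserving_eval_multivariateGaussian (μ := 0) hS (i := i)).measure_preimage
    hA.nullMeasurableSet
  rw [hdiag, Real.toNNReal_one] at this
  exact this

/-- The residuals of the regression of the coordinates on the `i`-th one. -/
def residual (S : Matrix (Fin n) (Fin n) ℝ) (i : Fin n) (x : EuclideanSpace ℝ (Fin n)) :
    Fin n → ℝ := fun j => x j - S i j * x i

lemma measurable_residual (i : Fin n) : Measurable (residual S i) := by
  unfold residual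
  fun_prop

/-- The pair is jointly Gaussian, and the covariance of `x i` with the `j`-th residual is `S i j - S
i j * S i i = 0`. -/
lemma indepFun_residual (hS : S.PosSemidef) (hdiag : ∀ i, S i i = 1) (i : Fin n) :
    IndepFun (fun x : EuclideanSpace ℝ (Fin n) => x i) (residual S i)
      (multivariateGaussian 0 S) := by
  set μ := multivariateGaussian (0 : EuclideanSpace ℝ (Fin n)) S with hμ
  let L : EuclideanSpace ℝ (Fin n) →L[ℝ] (Unit → ℝ) × (Fin n → ℝ) :=
    (ContinuousLinearMap.pi fun _ => EuclideanSpace.proj i).prod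
      (ContinuousLinearMap.pi fun j => EuclideanSpace.proj j - S i j • EuclideanSpace.proj i)
  have hid : HasGaussianLaw (id : EuclideanSpace ℝ (Fin n) → _) μ :=
    ⟨by rw [Measure.map_id]; infer_instance⟩
  have hL := hid.map L
  have hind : IndepFun (fun (x : EuclideanSpace ℝ (Fin n)) (_ : Unit) => x i)
      (fun x j => x j - S i j * x i) μ := by
    refine HasGaussianLaw.indepFun_of_covariance_eval (X := fun _ (x : EuclideanSpace ℝ (Fin n)) => x i)
      (Y := fun j (x : EuclideanSpace ℝ (Fin n)) => x j - S i j * x i) (by exact hL) ?_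
    intro _ j
    have hmem (k : Fin n) : MemLp (fun x : EuclideanSpace ℝ (Fin n) => x k) 2 μ :=
      (EuclideanSpace.proj (𝕜 := ℝ) k).comp_memLp' IsGaussian.memLp_two_id
    rw [covariance_fun_sub_right (hmem i) (hmem j) ((hmem i).const_mul _),
      covariance_const_mul_right, covariance_eval_multivariateGaussian hS,
      covariance_eval_multivariateGaussian hS, hdiag]
    ring
  exact hind.comp (φ := fun f : Unit → ℝ => f ()) (ψ := id) (by fun_prop) measurable_id

/-- The conditional probability of a section of `E` given the `i`-th coordinate. -/
def regressionKernel (S : Matrix (Fin n) (Fin n) ℝ) (i : Fin n)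
    (E : Set (EuclideanSpace ℝ (Fin n) × ℝ)) (p : ℝ × ℝ) : ENNReal :=
  (multivariateGaussian 0 S).map (residual S i)
    {r | (WithLp.toLp 2 fun j => S i j * p.1 + r j, p.2) ∈ E}

lemma regressionKernel_mono {i : Fin n} {E : Set (EuclideanSpace ℝ (Fin n) × ℝ)} {p p' : ℝ × ℝ}
    (h : ∀ r : Fin n → ℝ, (WithLp.toLp 2 fun j => S i j * p'.1 + r j, p'.2) ∈ E →
      (WithLp.toLp 2 fun j => S i j * p.1 + r j, p.2) ∈ E) :
    regressionKernel S i E p' ≤ regressionKernel S i E p :=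
  measure_mono h

lemma measurableSet_regression {i : Fin n} {E : Set (EuclideanSpace ℝ (Fin n) × ℝ)}
    (hE : MeasurableSet E) : MeasurableSet {q : (ℝ × ℝ) × (Fin n → ℝ) |
      ((WithLp.toLp 2 fun j => S i j * q.1.1 + q.2 j : EuclideanSpace ℝ (Fin n)), q.1.2) ∈ E} := by
  refine hE.preimage (Measurable.prodMk ?_ (by fun_prop))
  exact (WithLp.measurable_toLp 2 _).comp (by fun_prop)

lemma measurable_regressionKernel {i : Fin n} {E : Set (EuclideanSpace ℝ (Fin n) × ℝ)}
    (hE : MeasurableSet E) : Measurable (regressionKernel S i E) :=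
  measurable_measure_prodMk_left (measurableSet_regression hE)

/-- The vector is rebuilt from `x i` and its residuals, whose joint law is a product, so Fubini
yields the conditional probability as a function of `x i`. -/
lemma multivariateGaussian_inter_eq_lintegral (hS : S.PosSemidef) (hdiag : ∀ i, S i i = 1)
    {i : Fin n} {E : Set (EuclideanSpace ℝ (Fin n) × ℝ)} (hE : MeasurableSet E) (z : ℝ)
    {A : Set ℝ} (hA : MeasurableSet A) :
    multivariateGaussian 0 S {x | (x, z) ∈ E ∧ x i ∈ A} =
      ∫⁻ x in A, regressionKernel S i E (x, z) ∂gaussianReal 0 1 := by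
  set μ := multivariateGaussian (0 : EuclideanSpace ℝ (Fin n)) S with hμ
  have hlaw : μ.map (fun x => (x i, residual S i x)) =
      (gaussianReal 0 1).prod (μ.map (residual S i)) := by
    rw [(indepFun_iff_map_prod_eq_prod_map_map (by fun_prop)
      (measurable_residual i).aemeasurable).mp (indepFun_residual hS hdiag i)]
    congr 1
    ext B hB
    rw [Measure.map_apply (by fun_prop) hB]
    exact multivariateGaussian_eval hS hdiag i B hB
  set F : Set (ℝ × (Fin n → ℝ)) :=
    {q | (WithLp.toLp 2 fun j => S i j * q.1 + q.2 j, z) ∈ E ∧ q.1 ∈ A} with hF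
  have hF1 : MeasurableSet {q : ℝ × (Fin n → ℝ) |
      ((WithLp.toLp 2 fun j => S i j * q.1 + q.2 j : EuclideanSpace ℝ (Fin n)), z) ∈ E} :=
    (measurableSet_regression hE).preimage
      (f := fun q : ℝ × (Fin n → ℝ) => ((q.1, z), q.2)) (by fun_prop)
  have hFm : MeasurableSet F := hF1.inter (measurable_fst hA)
  have hpre : {x | (x, z) ∈ E ∧ x i ∈ A} = (fun x => (x i, residual S i x)) ⁻¹' F := by
    ext x
    have : (WithLp.toLp 2 fun j => S i j * x i + residual S i x j) = x := by
      ext j; simp [residual]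
    simp [hF, this]
  rw [hpre, ← Measure.map_apply (Measurable.prodMk (by fun_prop) (measurable_residual i)) hFm,
    hlaw, Measure.prod_apply hFm, ← lintegral_indicator hA]
  refine lintegral_congr fun x => ?_
  by_cases hx : x ∈ A
  · rw [Set.indicator_of_mem hx]
    have : Prod.mk x ⁻¹' F = {r | (WithLp.toLp 2 fun j => S i j * x + r j, z) ∈ E} := by
      ext r; simp [hF, hx]
    rw [this]
    rfl
  · rw [Set.indicator_of_notMem hx]
    have : Prod.mk x ⁻¹' F = ∅ := by
      ext r; simp [hF, hx]
    rw [this, measure_empty]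

lemma measurable_studentized (T : ℝ → ℝ) (hT : Measurable T) (i : Fin n) :
    Measurable fun p : EuclideanSpace ℝ (Fin n) × ℝ => T (p.2⁻¹ * p.1 i) :=
  hT.comp (by fun_prop)

/-- The Studentized positively correlated Gaussian vector, up to a global sign, satisfies the
dependence condition for nonpositive thresholds. -/
lemma tailDependent_studentized (hS : S.PosSemidef) (hdiag : ∀ i, S i i = 1)
    (hpos : ∀ i j, i ≠ j → 0 ≤ S i j) {ν : ℝ} (hν : 0 < ν) {s : ℝ} (hs : s = 1 ∨ s = -1)
    {a : Fin n → ℝ} (ha : ∀ k, a k ≤ 0) :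
    TailDependent ((multivariateGaussian 0 S).prod (scaledChiMeasure ν))
      (fun i p => s * (p.2⁻¹ * p.1 i)) a := by
  intro i r u t hut ⟨k₀, hk₀⟩
  have hT : Measurable fun x : ℝ => s * x := measurable_const_mul s
  have hE := measurableSet_tailEvent (fun i => measurable_studentized (fun x => s * x) hT i) a i r
  refine ratio_of_conditional hν hT (multivariateGaussian_eval hS hdiag i) hE
    (measurable_regressionKernel (S := S) (i := i) hE) (fun z t _ => ?_) hut ?_
  · exact multivariateGaussian_inter_eq_lintegral hS hdiag hE z
      (A := {x | s * (z⁻¹ * x) < t}) (measurableSet_lt (by fun_prop) measurable_const)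
  · intro y y' w hy hy' hy't hw
    -- The bound on `t` in `TailDependent` is used here: it keeps both ratios on the side where
    -- decreasing `s * y` means increasing `|y|`.
    have hsy' : s * y' ≤ 0 := (hy't.trans_le (hk₀.trans (ha k₀))).le
    have hsy : s * y ≤ s * y' := (hy.trans_le hy').le
    have habs (x : ℝ) (hx : s * x ≤ 0) : |x| = -(s * x) := by
      rcases hs with rfl | rfl
      · simp only [one_mul] at hx ⊢
        exact abs_of_nonpos hx
      · rw [abs_of_nonneg (by linarith)]; ring
    have hyy : |y'| ≤ |y| := by
      rw [habs y' hsy', habs y (hsy.trans hsy')]; linarith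
    have h1 := sqrt_div_le_of_abs_le hν hw hyy
    have h2 := sqrt_div_mul_abs_le hν hw hyy
    rw [habs y' hsy', habs y (hsy.trans hsy')] at h2
    have hθ : 0 < √(w / (ν + y ^ 2)) := Real.sqrt_pos.mpr (by positivity)
    have hθ' : 0 < √(w / (ν + y' ^ 2)) := Real.sqrt_pos.mpr (by positivity)
    set θ := √(w / (ν + y ^ 2))
    set θ' := √(w / (ν + y' ^ 2))
    refine regressionKernel_mono fun x hx => tailEvent_of_forall (fun j k hji hjk => ?_) hx
    dsimp only at hjk ⊢
    have e (c q : ℝ) (hc : 0 < c) : s * (c⁻¹ * q) < a k ↔ s * q < a k * c := by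
      rw [← div_lt_iff₀ hc]
      ring_nf
    rw [e _ _ hθ'] at hjk
    rw [e _ _ hθ]
    -- The regression term `s * S i j * x i` does not increase, while the bound `a k * z` does not
    -- decrease.
    have h3 := mul_le_mul_of_nonneg_left h2 (hpos i j hji.symm)
    have h4 := mul_le_mul_of_nonpos_left h1 (ha k)
    nlinarith

end Regression

end Simes

end

noncomputable section

namespace Simes

/-! ### The four functions theorem in the order of absolute values. -/

section FourFunctions

open scoped ENNReal

/-- From `(C - A) * (C - B) ≥ 0` follows `C * (A + B) ≤ C ^ 2 + A * B ≤ C * (C + E)`; then divide by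
`C`. -/
lemma add_le_add_of_mul_le_mul {A B C E : ℝ≥0∞} (hA : A ≤ C) (hB : B ≤ C)
    (h : A * B ≤ C * E) : A + B ≤ C + E := by
  rcases eq_or_ne C ⊤ with rfl | hC
  · simp
  rcases eq_or_ne E ⊤ with rfl | hE
  · simp
  lift C to NNReal using hC
  lift E to NNReal using hE
  lift A to NNReal using ne_top_of_le_ne_top ENNReal.coe_ne_top hA
  lift B to NNReal using ne_top_of_le_ne_top ENNReal.coe_ne_top hB
  norm_cast at *
  rcases eq_or_ne C 0 with rfl | hC
  · simp_all
  · have hC0 : (0 : ℝ) < C := by positivity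
    rw [← NNReal.coe_le_coe] at *
    push_cast at *
    refine le_of_mul_le_mul_left ?_ hC0
    nlinarith [mul_nonneg (sub_nonneg.mpr hA) (sub_nonneg.mpr hB)]

/-- Each product of integrals, doubled, is a double integral of a symmetrized integrand. Pointwise,
for `|y| < |x|`, both crossed products are at most `f₃ x * f₄ y`, and the diagonal cases of `h`
bound their product, so the preceding lemma applies. -/
lemma lintegral_four_functions {f₁ f₂ f₃ f₄ : ℝ → ℝ≥0∞} (h₁ : Measurable f₁)
    (h₂ : Measurable f₂) (h₃ : Measurable f₃) (h₄ : Measurable f₄)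
    (h : ∀ x y : ℝ, f₁ x * f₂ y ≤
      f₃ (if |y| ≤ |x| then x else y) * f₄ (if |y| ≤ |x| then y else x)) :
    (∫⁻ x, f₁ x) * ∫⁻ x, f₂ x ≤ (∫⁻ x, f₃ x) * ∫⁻ x, f₄ x := by
  have double {f g : ℝ → ℝ≥0∞} (hf : Measurable f) (hg : Measurable g) :
      2 * ((∫⁻ x, f x) * ∫⁻ x, g x) = ∫⁻ x, ∫⁻ y, (f x * g y + f y * g x) := by
    have e (x : ℝ) : ∫⁻ y, (f x * g y + f y * g x) =
        f x * (∫⁻ y, g y) + (∫⁻ y, f y) * g x := by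
      rw [lintegral_add_left (hg.const_mul _), lintegral_const_mul _ hg, lintegral_mul_const _ hf]
    simp_rw [e]
    rw [lintegral_add_left (hf.mul_const _), lintegral_mul_const _ hf, lintegral_const_mul _ hg,
      two_mul]
  have diag (x : ℝ) : f₁ x * f₂ x ≤ f₃ x * f₄ x := by simpa using h x x
  have strict (x y : ℝ) (hxy : |y| < |x|) :
      f₁ x * f₂ y + f₁ y * f₂ x ≤ f₃ x * f₄ y + f₃ y * f₄ x := by
    have a := h x y
    have b := h y x
    rw [if_pos hxy.le, if_pos hxy.le] at a
    rw [if_neg (not_le.mpr hxy), if_neg (not_le.mpr hxy)] at b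
    refine add_le_add_of_mul_le_mul a b ?_
    calc _ = (f₁ x * f₂ x) * (f₁ y * f₂ y) := by ring
      _ ≤ (f₃ x * f₄ x) * (f₃ y * f₄ y) := mul_le_mul' (diag x) (diag y)
      _ = _ := by ring
  have key (x y : ℝ) : f₁ x * f₂ y + f₁ y * f₂ x ≤ f₃ x * f₄ y + f₃ y * f₄ x := by
    rcases lt_trichotomy |y| |x| with hxy | hxy | hxy
    · exact strict x y hxy
    · have a := h x y
      have b := h y x
      rw [if_pos hxy.le, if_pos hxy.le] at a
      rw [if_pos hxy.ge, if_pos hxy.ge] at b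
      exact add_le_add a b
    · rw [add_comm, add_comm (f₃ x * _)]
      exact strict y x hxy
  rw [← ENNReal.mul_le_mul_iff_right two_ne_zero ENNReal.ofNat_ne_top, double h₁ h₂, double h₃ h₄]
  exact lintegral_mono fun x => lintegral_mono fun y => key x y

variable {ι : Type*}

/-- The coordinatewise choice of the entry of larger absolute value. -/
def absSup (x y : ι → ℝ) : ι → ℝ := fun i => if |y i| ≤ |x i| then x i else y i

/-- The coordinatewise choice of the entry of smaller absolute value. -/
def absInf (x y : ι → ℝ) : ι → ℝ := fun i => if |y i| ≤ |x i| then y i else x i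

lemma abs_absSup (x y : ι → ℝ) (i : ι) : |absSup x y i| = max |x i| |y i| := by
  unfold absSup
  split_ifs with h
  · exact (max_eq_left h).symm
  · exact (max_eq_right (le_of_not_ge h)).symm

lemma abs_absInf (x y : ι → ℝ) (i : ι) : |absInf x y i| = min |x i| |y i| := by
  unfold absInf
  split_ifs with h
  · exact (min_eq_right h).symm
  · exact (min_eq_left (le_of_not_ge h)).symm

variable [DecidableEq ι]

lemma absSup_update (x y : ι → ℝ) (i : ι) (a b : ℝ) :
    absSup (Function.update x i a) (Function.update y i b) =
      Function.update (absSup x y) i (if |b| ≤ |a| then a else b) := by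
  ext j
  by_cases h : j = i
  · subst h; simp [absSup]
  · simp [absSup, h]

lemma absInf_update (x y : ι → ℝ) (i : ι) (a b : ℝ) :
    absInf (Function.update x i a) (Function.update y i b) =
      Function.update (absInf x y) i (if |b| ≤ |a| then b else a) := by
  ext j
  by_cases h : j = i
  · subst h; simp [absInf]
  · simp [absInf, h]

/-- The four functions theorem of Ahlswede and Daykin for Lebesgue measure, with respect to the
lattice order of the absolute values of the coordinates. -/
lemma lmarginal_four_functions (s : Finset ι) {f₁ f₂ f₃ f₄ : (ι → ℝ) → ℝ≥0∞}
    (h₁ : Measurable f₁) (h₂ : Measurable f₂) (h₃ : Measurable f₃) (h₄ : Measurable f₄)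
    (h : ∀ x y, f₁ x * f₂ y ≤ f₃ (absSup x y) * f₄ (absInf x y)) (x y : ι → ℝ) :
    (∫⋯∫⁻_s, f₁ ∂fun _ => volume) x * (∫⋯∫⁻_s, f₂ ∂fun _ => volume) y ≤
      (∫⋯∫⁻_s, f₃ ∂fun _ => volume) (absSup x y) *
        (∫⋯∫⁻_s, f₄ ∂fun _ => volume) (absInf x y) := by
  induction s using Finset.induction_on generalizing x y with
  | empty => simpa using h x y
  | insert i s hi ih =>
    rw [lmarginal_insert f₁ h₁ hi, lmarginal_insert f₂ h₂ hi, lmarginal_insert f₃ h₃ hi,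
      lmarginal_insert f₄ h₄ hi]
    refine lintegral_four_functions ((h₁.lmarginal _).comp (measurable_update _))
      ((h₂.lmarginal _).comp (measurable_update _)) ((h₃.lmarginal _).comp (measurable_update _))
      ((h₄.lmarginal _).comp (measurable_update _)) fun a b => ?_
    -- Both choices act coordinatewise, so the induction hypothesis at updated points is the
    -- one-dimensional hypothesis.
    rw [← absSup_update, ← absInf_update]
    exact ih _ _

end FourFunctions

/-! ### Griffiths' inequality and log-supermodularity of the folded Gaussian. -/

section Spins

variable {ι : Type*}

/-- The value of a spin. -/
def spin (ε : ι → ℤˣ) (i : ι) : ℝ := ((ε i : ℤ) : ℝ)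

lemma spin_mul (ε η : ι → ℤˣ) (i : ι) : spin (ε * η) i = spin ε i * spin η i := by
  simp [spin]

lemma spin_eq_one_or (ε : ι → ℤˣ) (i : ι) : spin ε i = 1 ∨ spin ε i = -1 := by
  rcases Int.units_eq_one_or (ε i) with h | h <;> simp [spin, h]

lemma spin_mul_self (ε : ι → ℤˣ) (i : ι) : spin ε i * spin ε i = 1 := by
  rcases spin_eq_one_or ε i with h | h <;> simp [h]

variable [Fintype ι] [DecidableEq ι]

/-- The partition function of the Ising model with couplings `J`. -/
def spinSum (J : ι → ι → ℝ) : ℝ :=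
  ∑ ε : ι → ℤˣ, Real.exp (∑ i, ∑ j, J i j * (spin ε i * spin ε j))

lemma spinSum_pos (J : ι → ι → ℝ) : 0 < spinSum J :=
  Finset.sum_pos (fun _ _ => Real.exp_pos _) Finset.univ_nonempty

/-- The product of two spins as a character. -/
def spinPair (e : ι × ι) : (ι → ℤˣ) →* ℝ where
  toFun ε := spin ε e.1 * spin ε e.2
  map_one' := by simp [spin]
  map_mul' ε η := by rw [spin_mul, spin_mul]; ring

/-- A product of spin pairs is a character of a finite group, so its sum is either the order of the
group or zero. -/
lemma sum_prod_spinPair_nonneg {k : ℕ} (p : Fin k → ι × ι) :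
    0 ≤ ∑ ε : ι → ℤˣ, ∏ l, spinPair (p l) ε := by
  classical
  have : ∑ ε : ι → ℤˣ, ∏ l, spinPair (p l) ε = ∑ ε, (∏ l, spinPair (p l)) ε :=
    Finset.sum_congr rfl fun ε _ => (MonoidHom.finsetProd_apply _ _ _).symm
  rw [this, sum_hom_units]
  split_ifs <;> simp

/-- Expanding the power gives products of couplings with nonnegative character sums as coefficients,
so only absolute values of couplings matter. Summing the exponential series then compares the
partition functions. -/
lemma sum_pow_spin_le {J J' : ι → ι → ℝ} (h : ∀ i j, |J i j| ≤ J' i j) (k : ℕ) :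
    ∑ ε : ι → ℤˣ, (∑ i, ∑ j, J i j * (spin ε i * spin ε j)) ^ k ≤
      ∑ ε : ι → ℤˣ, (∑ i, ∑ j, J' i j * (spin ε i * spin ε j)) ^ k := by
  have expand (K : ι → ι → ℝ) :
      ∑ ε : ι → ℤˣ, (∑ i, ∑ j, K i j * (spin ε i * spin ε j)) ^ k =
        ∑ p : Fin k → ι × ι, (∏ l, K (p l).1 (p l).2) * ∑ ε, ∏ l, spinPair (p l) ε := by
    simp_rw [Finset.mul_sum]
    rw [Finset.sum_comm]
    refine Finset.sum_congr rfl fun ε _ => ?_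
    rw [← Fintype.sum_prod_type', Fintype.sum_pow]
    refine Finset.sum_congr rfl fun p _ => ?_
    rw [← Finset.prod_mul_distrib]
    rfl
  rw [expand, expand]
  refine Finset.sum_le_sum fun p _ =>
    mul_le_mul_of_nonneg_right ?_ (sum_prod_spinPair_nonneg p)
  calc _ ≤ |∏ l, J (p l).1 (p l).2| := le_abs_self _
    _ = ∏ l, |J (p l).1 (p l).2| := Finset.abs_prod _ _
    _ ≤ _ := Finset.prod_le_prod (fun _ _ => abs_nonneg _) fun _ _ => h _ _

lemma spinSum_le_of_abs_le {J J' : ι → ι → ℝ} (h : ∀ i j, |J i j| ≤ J' i j) :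
    spinSum J ≤ spinSum J' := by
  have hs (K : ι → ι → ℝ) : HasSum (fun k : ℕ =>
      ∑ ε : ι → ℤˣ, (∑ i, ∑ j, K i j * (spin ε i * spin ε j)) ^ k / (k.factorial : ℝ))
      (spinSum K) := by
    refine hasSum_sum fun ε _ => ?_
    rw [Real.exp_eq_exp_ℝ]
    exact NormedSpace.expSeries_div_hasSum_exp _
  refine hasSum_le (fun k => ?_) (hs J) (hs J')
  rw [← Finset.sum_div, ← Finset.sum_div]
  exact div_le_div_of_nonneg_right (sum_pow_spin_le h k) (by positivity)

/-- Spins square to one, so diagonal couplings contribute only a constant factor. This lets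
Griffiths' inequality ignore the signs of the diagonal. -/
lemma spinSum_add_diagonal (J : ι → ι → ℝ) (c : ι → ℝ) :
    spinSum (fun i j => J i j + if i = j then c i else 0) = Real.exp (∑ i, c i) * spinSum J := by
  rw [spinSum, spinSum, Finset.mul_sum]
  refine Finset.sum_congr rfl fun ε _ => ?_
  rw [← Real.exp_add]
  congr 1
  rw [← Finset.sum_add_distrib]
  refine Finset.sum_congr rfl fun i _ => ?_
  simp_rw [add_mul, ite_mul, zero_mul]
  rw [Finset.sum_add_distrib, Finset.sum_ite_eq, if_pos (Finset.mem_univ _), spin_mul_self]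
  ring

/-- Griffiths' inequality: the partition function of a ferromagnet dominates. -/
lemma spinSum_le_spinSum {J J' : ι → ι → ℝ} (hd : ∀ i, J i i = J' i i)
    (h : ∀ i j, i ≠ j → |J i j| ≤ J' i j) : spinSum J ≤ spinSum J' := by
  have key := spinSum_le_of_abs_le (J := fun i j => J i j + if i = j then -J i i else 0)
    (J' := fun i j => J' i j + if i = j then -J i i else 0) fun i j => by
      by_cases hij : i = j
      · subst hij; simp [hd]
      · simpa [hij] using h i j hij
  rw [spinSum_add_diagonal J (fun i => -J i i), spinSum_add_diagonal J' (fun i => -J i i)] at key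
  exact le_of_mul_le_mul_left key (Real.exp_pos _)

/-- The substitution `ε ↦ d * ε` permutes the configurations. -/
lemma spinSum_gauge (J : ι → ι → ℝ) (d : ι → ℤˣ) :
    spinSum (fun i j => spin d i * spin d j * J i j) = spinSum J := by
  rw [spinSum, spinSum]
  refine Fintype.sum_equiv (Equiv.mulLeft d) _ _ fun ε => ?_
  simp only [Equiv.coe_mulLeft, spin_mul]
  congr 1
  exact Finset.sum_congr rfl fun i _ => Finset.sum_congr rfl fun j _ => by ring

/-- Duplicated variables: writing the second configuration as `ε * η` leaves, for each fixed `η`, a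
single Ising model in `ε`. -/
lemma spinSum_mul_spinSum (J K : ι → ι → ℝ) :
    spinSum J * spinSum K = ∑ η : ι → ℤˣ,
      spinSum fun i j => J i j + spin η i * spin η j * K i j := by
  have h (ε : ι → ℤˣ) : spinSum K = ∑ η : ι → ℤˣ,
      Real.exp (∑ i, ∑ j, K i j * (spin (ε * η) i * spin (ε * η) j)) :=
    (Fintype.sum_equiv (Equiv.mulLeft ε) _ _ fun η => rfl).symm
  conv_lhs => rw [spinSum, Finset.sum_mul]
  conv_rhs => unfold spinSum; rw [Finset.sum_comm]
  refine Finset.sum_congr rfl fun ε _ => ?_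
  rw [h ε, Finset.mul_sum]
  refine Finset.sum_congr rfl fun η _ => ?_
  rw [← Real.exp_add]
  congr 1
  simp_rw [← Finset.sum_add_distrib]
  refine Finset.sum_congr rfl fun i _ => Finset.sum_congr rfl fun j _ => ?_
  rw [spin_mul, spin_mul]
  ring

/-- This compares the duplicated couplings, with `e` the product of two relative spins. For `e = 1`
it is the rearrangement inequality; for `e = -1` it bounds a difference of products by that of the
extremes. -/
lemma abs_add_mul_le_max_min {u u' v v' e : ℝ} (hu : 0 ≤ u) (hu' : 0 ≤ u') (hv : 0 ≤ v)
    (hv' : 0 ≤ v') (he : e = 1 ∨ e = -1) :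
    |u * u' + e * (v * v')| ≤ max u v * max u' v' + e * (min u v * min u' v') := by
  rcases le_total u v with h | h <;> rcases le_total u' v' with h' | h' <;>
    simp only [max_eq_left, max_eq_right, min_eq_left, min_eq_right, h, h'] <;>
    rcases he with rfl | rfl <;> rw [abs_le] <;> constructor <;>
    nlinarith [mul_nonneg hu hu', mul_nonneg hv hv', mul_nonneg hu hv', mul_nonneg hv hu',
      mul_nonneg (sub_nonneg.mpr h) (sub_nonneg.mpr h'), mul_nonneg (sub_nonneg.mpr h) hu',
      mul_nonneg (sub_nonneg.mpr h) hv', mul_nonneg (sub_nonneg.mpr h') hu,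
      mul_nonneg (sub_nonneg.mpr h') hv]

/-- The sum over all sign changes of the Gaussian kernel with precision matrix `Q`. -/
def foldedKernel (Q : Matrix ι ι ℝ) (x : ι → ℝ) : ℝ :=
  spinSum fun i j => -(Q i j / 2) * (x i * x j)

lemma foldedKernel_congr_abs (Q : Matrix ι ι ℝ) {x y : ι → ℝ} (h : ∀ i, |x i| = |y i|) :
    foldedKernel Q x = foldedKernel Q y := by
  have hd (i : ι) : ∃ e : ℤˣ, x i = ((e : ℤ) : ℝ) * y i := by
    rcases abs_eq_abs.mp (h i) with h | h
    · exact ⟨1, by simp [h]⟩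
    · exact ⟨-1, by simp [h]⟩
  choose d hd using hd
  unfold foldedKernel
  rw [← spinSum_gauge (fun i j => -(Q i j / 2) * (y i * y j)) d]
  congr 1
  ext i j
  rw [hd i, hd j]
  simp only [spin]
  ring

/-- Log-supermodularity of the density of the absolute values of a Gaussian vector. -/
lemma foldedKernel_mul_le {Q : Matrix ι ι ℝ} (d : ι → ℤˣ)
    (hQ : ∀ i j, i ≠ j → spin d i * spin d j * Q i j ≤ 0) (x y : ι → ℝ) :
    foldedKernel Q x * foldedKernel Q y ≤
      foldedKernel Q (absSup x y) * foldedKernel Q (absInf x y) := by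
  -- Absolute values replace the coordinates and the gauge `d` is inserted, after which all
  -- off-diagonal couplings are nonnegative.
  have e (z u : ι → ℝ) (hzu : ∀ i, |z i| = |u i|) : foldedKernel Q z =
      spinSum fun i j => -(spin d i * spin d j * Q i j / 2) * (u i * u j) := by
    rw [foldedKernel_congr_abs Q hzu, foldedKernel, ← spinSum_gauge _ d]
    congr 1
    ext i j
    ring
  rw [e x (fun i => |x i|) (by simp), e y (fun i => |y i|) (by simp),
    e (absSup x y) (fun i => max |x i| |y i|) 
      (fun i => (abs_absSup x y i).trans
        (abs_of_nonneg (le_max_of_le_left (abs_nonneg _))).symm),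
    e (absInf x y) (fun i => min |x i| |y i|) 
      (fun i => (abs_absInf x y i).trans
        (abs_of_nonneg (le_min (abs_nonneg _) (abs_nonneg _))).symm),
    spinSum_mul_spinSum, spinSum_mul_spinSum]
  refine Finset.sum_le_sum fun η _ => spinSum_le_spinSum (fun i => ?_) fun i j hij => ?_
  -- The diagonals agree because the squares of the maximum and minimum have the same sum as the
  -- original squares.
  · simp only [spin_mul_self]
    rcases le_total |x i| |y i| with h | h <;> simp [h] <;> ring
  · have hs : spin η i * spin η j = 1 ∨ spin η i * spin η j = -1 := by
      rcases spin_eq_one_or η i with h | h <;> rcases spin_eq_one_or η j with h' | h' <;>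
        simp [h, h']
    have hP : 0 ≤ -(spin d i * spin d j * Q i j / 2) := by linarith [hQ i j hij]
    have := abs_add_mul_le_max_min (abs_nonneg (x i)) (abs_nonneg (x j)) (abs_nonneg (y i))
      (abs_nonneg (y j)) hs
    set P := -(spin d i * spin d j * Q i j / 2)
    calc _ = P * |(|x i| * |x j| + spin η i * spin η j * (|y i| * |y j|))| := by
          conv_rhs => rw [← abs_of_nonneg hP, ← abs_mul]
          congr 1
          ring
      _ ≤ _ := mul_le_mul_of_nonneg_left this hP
      _ = _ := by ring

end Spins

end Simes

end

noncomputable section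

namespace Simes

/-! ### Densities of nondegenerate Gaussian vectors and of their absolute values. -/

section GaussianDensity

open scoped ENNReal MatrixOrder

variable {ι : Type*} [Fintype ι]

lemma lmarginal_prod_coord [DecidableEq ι] {f : ι → ℝ → ℝ≥0∞} (hf : ∀ i, Measurable (f i)) (s : Finset ι)
    (x : ι → ℝ) : (∫⋯∫⁻_s, (fun x => ∏ i, f i (x i)) ∂fun _ => volume) x =
      (∏ i ∈ s, ∫⁻ t, f i t) * ∏ i ∈ sᶜ, f i (x i) := by
  have hm : Measurable fun x : ι → ℝ => ∏ i, f i (x i) :=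
    Finset.measurable_prod _ fun i _ => (hf i).comp (measurable_pi_apply i)
  induction s using Finset.induction_on generalizing x with
  | empty => simp
  | insert i s hi ih =>
    rw [lmarginal_insert _ hm hi]
    simp_rw [ih]
    have hs : sᶜ = insert i (insert i s)ᶜ := by
      ext j
      by_cases hj : j = i <;> simp [hj, hi]
    have e (t : ℝ) : ∏ j ∈ sᶜ, f j (Function.update x i t j) =
        f i t * ∏ j ∈ (insert i s)ᶜ, f j (x j) := by
      rw [hs, Finset.prod_insert (by simp), Function.update_self]
      congr 1
      refine Finset.prod_congr rfl fun j hj => ?_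
      rw [Function.update_of_ne]
      rintro rfl
      simp at hj
    simp_rw [e]
    rw [Finset.prod_insert hi, lintegral_const_mul _ ((hf i).mul_const _),
      lintegral_mul_const _ (hf i)]
    ring

lemma lintegral_prod_coord {f : ι → ℝ → ℝ≥0∞} (hf : ∀ i, Measurable (f i)) :
    ∫⁻ x : ι → ℝ, ∏ i, f i (x i) = ∏ i, ∫⁻ t, f i t := by
  classical
  have := lmarginal_prod_coord hf Finset.univ 0
  rw [lmarginal_univ] at this
  simpa [volume_pi] using this

lemma pi_gaussianReal_eq_withDensity :
    Measure.pi (fun _ : ι => gaussianReal 0 1) =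
      volume.withDensity fun x : ι → ℝ => ∏ i, gaussianPDF 0 1 (x i) := by
  refine (Measure.pi_eq fun s hs => ?_)
  have hpi : MeasurableSet (Set.univ.pi s) := MeasurableSet.univ_pi hs
  rw [withDensity_apply _ hpi, ← lintegral_indicator hpi]
  have e (x : ι → ℝ) : (Set.univ.pi s).indicator (fun x => ∏ i, gaussianPDF 0 1 (x i)) x =
      ∏ i, (s i).indicator (gaussianPDF 0 1) (x i) := by
    by_cases hx : x ∈ Set.univ.pi s
    · rw [Set.indicator_of_mem hx]
      exact Finset.prod_congr rfl fun i _ => (Set.indicator_of_mem (hx i trivial) _).symm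
    · rw [Set.indicator_of_notMem hx]
      obtain ⟨i, hi⟩ : ∃ i, x i ∉ s i := by simpa [Set.mem_univ_pi] using hx
      exact (Finset.prod_eq_zero (Finset.mem_univ i) (Set.indicator_of_notMem hi _)).symm
  simp_rw [e]
  rw [lintegral_prod_coord fun i => (measurable_gaussianPDF 0 1).indicator (hs i)]
  refine Finset.prod_congr rfl fun i _ => ?_
  rw [gaussianReal_of_var_ne_zero 0 one_ne_zero, withDensity_apply _ (hs i),
    lintegral_indicator (hs i)]

/-- The Gaussian kernel with precision matrix `Q`. -/
def gaussianKernel (Q : Matrix ι ι ℝ) (x : ι → ℝ) : ℝ := Real.exp (-(x ⬝ᵥ Q *ᵥ x) / 2)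

lemma measurable_ofReal_gaussianKernel (Q : Matrix ι ι ℝ) :
    Measurable fun x => ENNReal.ofReal (gaussianKernel Q x) := by
  refine Measurable.ennreal_ofReal ?_
  unfold gaussianKernel
  simp only [dotProduct, Matrix.mulVec]
  fun_prop

lemma gaussianKernel_nonneg (Q : Matrix ι ι ℝ) (x : ι → ℝ) : 0 ≤ gaussianKernel Q x :=
  (Real.exp_pos _).le

lemma prod_gaussianPDF [DecidableEq ι] (x : ι → ℝ) : ∏ i, gaussianPDF 0 1 (x i) =
    ENNReal.ofReal ((√(2 * Real.pi))⁻¹ ^ Fintype.card ι) *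
      ENNReal.ofReal (gaussianKernel (1 : Matrix ι ι ℝ) x) := by
  simp only [gaussianPDF, gaussianPDFReal]
  rw [← ENNReal.ofReal_prod_of_nonneg (fun i _ => by positivity), ← ENNReal.ofReal_mul (by positivity),
    Finset.prod_mul_distrib, ← Real.exp_sum]
  simp only [NNReal.coe_one, mul_one, sub_zero, Finset.prod_const, Finset.card_univ,
    gaussianKernel, Matrix.one_mulVec, dotProduct]
  rw [← Finset.sum_div, Finset.sum_neg_distrib]
  simp_rw [sq]

lemma lintegral_comp_mulVec [DecidableEq ι] {B : Matrix ι ι ℝ} (hB : B.det ≠ 0) {F : (ι → ℝ) → ℝ≥0∞}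
    (hF : Measurable F) :
    ∫⁻ x, F (B *ᵥ x) = ENNReal.ofReal |(B.det)⁻¹| * ∫⁻ x, F x := by
  have hm : Measurable (Matrix.toLin' B) := (LinearMap.continuous_of_finiteDimensional _).measurable
  rw [← smul_eq_mul, ← lintegral_smul_measure, ← Real.map_matrix_volume_pi_eq_smul_volume_pi hB,
    lintegral_map hF hm]
  simp

/-- The density of a nondegenerate Gaussian vector, up to a constant. -/
lemma exists_lintegral_multivariateGaussian [DecidableEq ι] {S : Matrix ι ι ℝ} (hS : S.PosDef) :
    ∃ C : ℝ≥0∞, ∀ F : (ι → ℝ) → ℝ≥0∞, Measurable F →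
      ∫⁻ x, F (WithLp.ofLp x) ∂multivariateGaussian 0 S =
        C * ∫⁻ x, F x * ENNReal.ofReal (gaussianKernel S⁻¹ x) := by
  set B := CFC.sqrt S with hBdef
  have hBB : B * B = S := CFC.sqrt_mul_sqrt_self _ hS.posSemidef.nonneg
  have hBsymm : Bᵀ = B := by
    have : B.PosSemidef := Matrix.nonneg_iff_posSemidef.mp (CFC.sqrt_nonneg S)
    simpa using this.isHermitian.eq
  have hdet : B.det ≠ 0 := by
    intro h
    have := hS.det_pos
    rw [← hBB, Matrix.det_mul, h] at this
    simp at this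
  have hunit : IsUnit B.det := isUnit_iff_ne_zero.mpr hdet
  have hker (x : ι → ℝ) : gaussianKernel (1 : Matrix ι ι ℝ) x = gaussianKernel S⁻¹ (B *ᵥ x) := by
    unfold gaussianKernel
    have : (B *ᵥ x) ⬝ᵥ S⁻¹ *ᵥ (B *ᵥ x) = x ⬝ᵥ (1 : Matrix ι ι ℝ) *ᵥ x := by
      rw [← hBB, Matrix.mul_inv_rev, Matrix.mulVec_mulVec, Matrix.mul_assoc,
        Matrix.nonsing_inv_mul _ hunit, Matrix.mul_one, Matrix.dotProduct_mulVec,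
        Matrix.one_mulVec, ← Matrix.mulVec_transpose, Matrix.mulVec_mulVec,
        Matrix.transpose_nonsing_inv, hBsymm, Matrix.nonsing_inv_mul _ hunit, Matrix.one_mulVec]
    rw [this]
  refine ⟨ENNReal.ofReal ((√(2 * Real.pi))⁻¹ ^ Fintype.card ι) * ENNReal.ofReal |(B.det)⁻¹|,
    fun F hF => ?_⟩
  have hmul : Measurable fun x : ι → ℝ => B *ᵥ x := by
    exact measurable_pi_lambda _ fun i => Finset.measurable_sum _ fun j _ => by fun_prop
  -- The vector is the symmetric square root of `S` applied to a standard Gaussian vector, so a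
  -- linear change of variables gives its density.
  have hlaw : (multivariateGaussian 0 S).map WithLp.ofLp =
      (Measure.pi fun _ : ι => gaussianReal 0 1).map fun x => B *ᵥ x := by
    rw [multivariateGaussian, ← map_pi_eq_stdGaussian, Measure.map_map (by fun_prop) (by fun_prop),
      Measure.map_map (by fun_prop) (by fun_prop)]
    congr 1
    ext x i
    simp [hBdef]
  have hpdf : Measurable fun x : ι → ℝ => ∏ i, gaussianPDF 0 1 (x i) :=
    Finset.measurable_prod _ fun i _ => (measurable_gaussianPDF 0 1).comp (measurable_pi_apply i)
  have hFk : Measurable fun x => F x * ENNReal.ofReal (gaussianKernel S⁻¹ x) :=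
    hF.mul (measurable_ofReal_gaussianKernel _)
  have hFk' : Measurable fun x => F (B *ᵥ x) * ENNReal.ofReal (gaussianKernel S⁻¹ (B *ᵥ x)) :=
    hFk.comp hmul
  rw [← lintegral_map hF (by fun_prop), hlaw, lintegral_map hF hmul,
    pi_gaussianReal_eq_withDensity,
    lintegral_withDensity_eq_lintegral_mul₀ hpdf.aemeasurable (g := fun x => F (B *ᵥ x))
      (hF.comp hmul).aemeasurable, mul_assoc,
    ← lintegral_comp_mulVec hdet hFk, ← lintegral_const_mul _ hFk']
  refine lintegral_congr fun x => ?_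
  simp only [Pi.mul_apply, prod_gaussianPDF, hker]
  ring

lemma measurePreserving_spin (ε : ι → ℤˣ) :
    MeasurePreserving fun (x : ι → ℝ) i => spin ε i * x i := by
  refine volume_preserving_pi (f := fun i t => spin ε i * t) fun i => ⟨measurable_const_mul _, ?_⟩
  have h : |spin ε i| = 1 ∧ spin ε i ≠ 0 := by
    rcases spin_eq_one_or ε i with h | h <;> simp [h]
  have := Real.smul_map_volume_mul_left h.2
  rwa [h.1, ENNReal.ofReal_one, one_smul] at this

lemma foldedKernel_eq_sum [DecidableEq ι] (Q : Matrix ι ι ℝ) (x : ι → ℝ) :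
    foldedKernel Q x = ∑ ε : ι → ℤˣ, gaussianKernel Q fun i => spin ε i * x i := by
  refine Finset.sum_congr rfl fun ε _ => ?_
  rw [gaussianKernel]
  congr 1
  simp only [dotProduct, Matrix.mulVec, Finset.mul_sum, neg_div, Finset.sum_div]
  rw [← Finset.sum_neg_distrib]
  refine Finset.sum_congr rfl fun i _ => ?_
  rw [← Finset.sum_neg_distrib]
  refine Finset.sum_congr rfl fun j _ => ?_
  ring

lemma foldedKernel_pos [DecidableEq ι] (Q : Matrix ι ι ℝ) (x : ι → ℝ) : 0 < foldedKernel Q x := spinSum_pos _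

lemma measurable_foldedKernel [DecidableEq ι] (Q : Matrix ι ι ℝ) : Measurable (foldedKernel Q) := by
  unfold foldedKernel spinSum
  fun_prop

/-- Sign flips preserve both Lebesgue measure and `F`, so all `2 ^ card ι` summands have the same
integral. -/
lemma lintegral_mul_foldedKernel [DecidableEq ι] (Q : Matrix ι ι ℝ) {F : (ι → ℝ) → ℝ≥0∞} (hF : Measurable F)
    (habs : ∀ x y : ι → ℝ, (∀ i, |x i| = |y i|) → F x = F y) :
    ∫⁻ x, F x * ENNReal.ofReal (foldedKernel Q x) =
      2 ^ Fintype.card ι * ∫⁻ x, F x * ENNReal.ofReal (gaussianKernel Q x) := by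
  have e (x : ι → ℝ) : F x * ENNReal.ofReal (foldedKernel Q x) = ∑ ε : ι → ℤˣ,
      (fun x => F x * ENNReal.ofReal (gaussianKernel Q x)) fun i => spin ε i * x i := by
    rw [foldedKernel_eq_sum, ENNReal.ofReal_sum_of_nonneg fun ε _ => gaussianKernel_nonneg _ _,
      Finset.mul_sum]
    refine Finset.sum_congr rfl fun ε _ => ?_
    rw [habs x fun i => spin ε i * x i]
    intro i
    rcases spin_eq_one_or ε i with h | h <;> simp [h]
  have hm (ε : ι → ℤˣ) : Measurable fun x : ι → ℝ =>
      (fun x => F x * ENNReal.ofReal (gaussianKernel Q x)) fun i => spin ε i * x i :=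
    (hF.mul (measurable_ofReal_gaussianKernel Q)).comp (measurePreserving_spin ε).measurable
  rw [lintegral_congr e, lintegral_finsetSum _ fun ε _ => hm ε]
  have e2 (ε : ι → ℤˣ) : ∫⁻ x : ι → ℝ, (fun x => F x * ENNReal.ofReal (gaussianKernel Q x))
      (fun i => spin ε i * x i) = ∫⁻ x, F x * ENNReal.ofReal (gaussianKernel Q x) :=
    (measurePreserving_spin ε).lintegral_comp (hF.mul (measurable_ofReal_gaussianKernel Q))
  simp only [e2]
  simp

/-- Absolute values of a nondegenerate Gaussian vector have a density proportional to
`foldedKernel`. -/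
lemma exists_lintegral_foldedKernel [DecidableEq ι] {S : Matrix ι ι ℝ} (hS : S.PosDef) :
    ∃ C : ℝ≥0∞, ∀ F : (ι → ℝ) → ℝ≥0∞, Measurable F →
      (∀ x y : ι → ℝ, (∀ i, |x i| = |y i|) → F x = F y) →
      ∫⁻ x, F (WithLp.ofLp x) ∂multivariateGaussian 0 S =
        C * ∫⁻ x, F x * ENNReal.ofReal (foldedKernel S⁻¹ x) := by
  obtain ⟨C, hC⟩ := exists_lintegral_multivariateGaussian hS
  refine ⟨C / 2 ^ Fintype.card ι, fun F hF habs => ?_⟩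
  rw [hC F hF, lintegral_mul_foldedKernel _ hF habs, ← mul_assoc, ENNReal.div_mul_cancel]
  · positivity
  · finiteness

/-- Marginalization of the Gaussian kernel onto one coordinate. -/
lemma lmarginal_gaussianKernel [DecidableEq ι] {Q S : Matrix ι ι ℝ} (hQ : Qᵀ = Q) (hQS : Q * S = 1) (i : ι)
    (hi : S i i = 1) (t : ℝ) :
    (∫⋯∫⁻_{i}ᶜ, (fun x => ENNReal.ofReal (gaussianKernel Q x)) ∂fun _ => volume)
        (Function.update 0 i t) =
      ENNReal.ofReal (Real.exp (-t ^ 2 / 2)) *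
        (∫⋯∫⁻_{i}ᶜ, (fun x => ENNReal.ofReal (gaussianKernel Q x)) ∂fun _ => volume) 0 := by
  have hm : Measurable fun y : ({i}ᶜ : Finset ι) → ℝ =>
      ENNReal.ofReal (gaussianKernel Q (Function.updateFinset 0 {i}ᶜ y)) :=
    (measurable_ofReal_gaussianKernel Q).comp measurable_updateFinset
  rw [lmarginal, lmarginal, ← lintegral_const_mul _ hm]
  -- Translating along the regression line, the multiples of the `i`-th column of `S`, completes the
  -- square: the cross term vanishes and the quadratic form gains `t ^ 2`.
  rw [← lintegral_add_right_eq_self _ (fun j : ({i}ᶜ : Finset ι) => t * S j i)]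
  refine lintegral_congr fun y => ?_
  set r := Function.updateFinset (0 : ι → ℝ) {i}ᶜ y with hr
  have hri : r i = 0 := by simp [hr, Function.updateFinset]
  have hsum : Function.updateFinset (Function.update (0 : ι → ℝ) i t) {i}ᶜ
      (y + fun j : ({i}ᶜ : Finset ι) => t * S j i) = r + t • (S *ᵥ Pi.single i 1) := by
    ext j
    by_cases hj : j = i
    · subst hj; simp [hr, Function.updateFinset, hi]
    · simp [hr, Function.updateFinset, hj]
  rw [hsum, ← ENNReal.ofReal_mul (Real.exp_pos _).le, gaussianKernel, gaussianKernel,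
    ← Real.exp_add]
  congr 2
  have h1 : Q *ᵥ (S *ᵥ Pi.single i 1) = Pi.single i 1 := by
    rw [Matrix.mulVec_mulVec, hQS, Matrix.one_mulVec]
  have h2 : (S *ᵥ Pi.single i 1) ⬝ᵥ Q *ᵥ r = 0 := by
    rw [Matrix.dotProduct_mulVec, ← Matrix.mulVec_transpose, hQ, h1]
    simp [hri]
  have h3 : (r + t • (S *ᵥ Pi.single i 1)) ⬝ᵥ Q *ᵥ (r + t • (S *ᵥ Pi.single i 1)) =
      r ⬝ᵥ Q *ᵥ r + t ^ 2 := by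
    rw [Matrix.mulVec_add, Matrix.mulVec_smul, h1, add_dotProduct, dotProduct_add, dotProduct_add,
      smul_dotProduct, smul_dotProduct, dotProduct_smul, dotProduct_smul, h2]
    simp [hri, hi]
    ring
  rw [h3]
  ring

end GaussianDensity

end Simes

end

noncomputable section

namespace Simes

/-! ### Conditional monotonicity for absolute values. -/

section Folded

open scoped ENNReal

variable {n : ℕ} {S : Matrix (Fin n) (Fin n) ℝ}

lemma gaussianKernel_conj (Q D : Matrix (Fin n) (Fin n) ℝ) (x : Fin n → ℝ) :
    gaussianKernel (Dᵀ * Q * D) x = gaussianKernel Q (D *ᵥ x) := by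
  unfold gaussianKernel
  rw [← Matrix.mulVec_mulVec, ← Matrix.mulVec_mulVec, Matrix.dotProduct_mulVec x Dᵀ,
    Matrix.vecMul_transpose]

/-- Every summand of `foldedKernel` is a Gaussian kernel whose covariance `D * S * D` still has unit
diagonal, so all summands have the same marginal shape. -/
lemma lmarginal_foldedKernel (hS : S.PosDef) (hdiag : ∀ i, S i i = 1) (i : Fin n) (t : ℝ) :
    (∫⋯∫⁻_{i}ᶜ, (fun x => ENNReal.ofReal (foldedKernel S⁻¹ x)) ∂fun _ => volume)
        (Function.update 0 i t) =
      ENNReal.ofReal (Real.exp (-t ^ 2 / 2)) *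
        (∫⋯∫⁻_{i}ᶜ, (fun x => ENNReal.ofReal (foldedKernel S⁻¹ x)) ∂fun _ => volume) 0 := by
  set D : (Fin n → ℤˣ) → Matrix (Fin n) (Fin n) ℝ := fun ε => Matrix.diagonal (spin ε) with hD
  have hDD (ε) : D ε * D ε = 1 := by
    simp [hD, Matrix.diagonal_mul_diagonal, spin_mul_self]
  have hsum (x : Fin n → ℝ) : ENNReal.ofReal (foldedKernel S⁻¹ x) =
      ∑ ε : Fin n → ℤˣ, ENNReal.ofReal (gaussianKernel ((D ε)ᵀ * S⁻¹ * D ε) x) := by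
    rw [foldedKernel_eq_sum, ENNReal.ofReal_sum_of_nonneg fun ε _ => gaussianKernel_nonneg _ _]
    refine Finset.sum_congr rfl fun ε _ => ?_
    rw [gaussianKernel_conj]
    congr 2
    ext j
    simp [hD, Matrix.mulVec_diagonal]
  have hmarg (x : Fin n → ℝ) :
      (∫⋯∫⁻_{i}ᶜ, (fun x => ENNReal.ofReal (foldedKernel S⁻¹ x)) ∂fun _ => volume) x =
        ∑ ε : Fin n → ℤˣ, (∫⋯∫⁻_{i}ᶜ, (fun x => ENNReal.ofReal
          (gaussianKernel ((D ε)ᵀ * S⁻¹ * D ε) x)) ∂fun _ => volume) x := by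
    simp only [lmarginal, hsum]
    exact lintegral_finsetSum _ fun ε _ =>
      (measurable_ofReal_gaussianKernel _).comp measurable_updateFinset
  rw [hmarg, hmarg, Finset.mul_sum]
  refine Finset.sum_congr rfl fun ε _ => ?_
  have hdet : IsUnit S.det := isUnit_iff_ne_zero.mpr hS.det_pos.ne'
  have hsymm : Sᵀ = S := by simpa using hS.isHermitian.eq
  have hDt : (D ε)ᵀ = D ε := by simp [hD]
  refine lmarginal_gaussianKernel (S := D ε * S * D ε) ?_ ?_ i ?_ t
  · simp only [Matrix.transpose_mul, Matrix.transpose_transpose, Matrix.transpose_nonsing_inv,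
      hsymm, Matrix.mul_assoc]
  · calc _ = D ε * S⁻¹ * (D ε * D ε) * S * D ε := by rw [hDt]; simp only [Matrix.mul_assoc]
      _ = 1 := by
        rw [hDD, Matrix.mul_one, Matrix.mul_assoc (D ε), Matrix.nonsing_inv_mul _ hdet,
          Matrix.mul_one, hDD]
  · simp [hD, Matrix.diagonal_mul, Matrix.mul_diagonal, hdiag, spin_mul_self]

lemma lintegral_eq_lintegral_lmarginal {F : (Fin n → ℝ) → ℝ≥0∞} (hF : Measurable F) (i : Fin n) :
    ∫⁻ x, F x = ∫⁻ t, (∫⋯∫⁻_{i}ᶜ, F ∂fun _ => volume) (Function.update 0 i t) := by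
  have huniv : (Finset.univ : Finset (Fin n)) = insert i {i}ᶜ := by
    ext j; simp
  rw [volume_pi, lintegral_eq_lmarginal_univ (0 : Fin n → ℝ), huniv, lmarginal_insert _ hF (by simp)]

/-- The marginal density at `p.1` of the `i`-th coordinate on the section of `E` at `p.2`. -/
def foldedMarginal (S : Matrix (Fin n) (Fin n) ℝ) (i : Fin n)
    (E : Set (EuclideanSpace ℝ (Fin n) × ℝ)) (p : ℝ × ℝ) : ℝ≥0∞ :=
  (∫⋯∫⁻_{i}ᶜ, ({x | (WithLp.toLp 2 x, p.2) ∈ E}.indicator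
    fun x => ENNReal.ofReal (foldedKernel S⁻¹ x)) ∂fun _ => volume) (Function.update 0 i p.1)

variable {E : Set (EuclideanSpace ℝ (Fin n) × ℝ)}

lemma measurableSet_section (hE : MeasurableSet E) (z : ℝ) :
    MeasurableSet {x : Fin n → ℝ | (WithLp.toLp 2 x, z) ∈ E} :=
  hE.preimage (Measurable.prodMk (WithLp.measurable_toLp 2 _) measurable_const)

lemma measurable_section (hE : MeasurableSet E) (z : ℝ) :
    Measurable ({x : Fin n → ℝ | (WithLp.toLp 2 x, z) ∈ E}.indicator
      fun x => ENNReal.ofReal (foldedKernel S⁻¹ x)) :=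
  (measurable_foldedKernel _).ennreal_ofReal.indicator (measurableSet_section hE z)

lemma measurable_foldedMarginal (hE : MeasurableSet E) (i : Fin n) :
    Measurable (foldedMarginal S i E) := by
  have hu : Measurable fun q : (ℝ × ℝ) × (({i}ᶜ : Finset (Fin n)) → ℝ) =>
      Function.updateFinset (Function.update (0 : Fin n → ℝ) i q.1.1) {i}ᶜ q.2 := by
    refine measurable_pi_lambda _ fun j => ?_
    by_cases hj : j = i
    · subst hj
      simp only [Function.updateFinset, Finset.mem_compl, Finset.mem_singleton, not_true_eq_false,
        dite_false, Function.update_self]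
      fun_prop
    · simp only [Function.updateFinset, Finset.mem_compl, Finset.mem_singleton, hj,
        not_false_eq_true, dite_true]
      fun_prop
  have hset : MeasurableSet {q : (ℝ × ℝ) × (({i}ᶜ : Finset (Fin n)) → ℝ) |
      ((WithLp.toLp 2 (Function.updateFinset (Function.update (0 : Fin n → ℝ) i q.1.1) {i}ᶜ q.2) :
        EuclideanSpace ℝ (Fin n)), q.1.2) ∈ E} :=
    hE.preimage (Measurable.prodMk ((WithLp.measurable_toLp 2 _).comp hu) (by fun_prop))
  exact Measurable.lintegral_prod_right'
    (((measurable_foldedKernel S⁻¹).ennreal_ofReal.comp hu).indicator hset)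

lemma foldedMarginal_mono {i : Fin n} {t z z' : ℝ}
    (h : ∀ x, (x, z') ∈ E → (x, z) ∈ E) :
    foldedMarginal S i E (t, z') ≤ foldedMarginal S i E (t, z) :=
  lmarginal_mono (fun _ => Set.indicator_le_indicator_of_subset (fun _ hx => h _ hx)
    (fun _ => zero_le) _) _

/-- The normalizing constant of `foldedKernel`. -/
def foldedConst (hS : S.PosDef) : ℝ≥0∞ := (exists_lintegral_foldedKernel hS).choose

lemma lintegral_foldedConst (hS : S.PosDef) {F : (Fin n → ℝ) → ℝ≥0∞} (hF : Measurable F)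
    (habs : ∀ x y : Fin n → ℝ, (∀ i, |x i| = |y i|) → F x = F y) :
    ∫⁻ x, F (WithLp.ofLp x) ∂multivariateGaussian 0 S =
      foldedConst hS * ∫⁻ x, F x * ENNReal.ofReal (foldedKernel S⁻¹ x) :=
  (exists_lintegral_foldedKernel hS).choose_spec F hF habs

/-- Both sides are multiples of `exp (-t ^ 2 / 2)` with total mass one, which fixes the constant. -/
lemma foldedConst_mul_foldedMarginal_univ (hS : S.PosDef) (hdiag : ∀ i, S i i = 1) (i : Fin n)
    (t z : ℝ) : foldedConst hS * foldedMarginal S i Set.univ (t, z) = gaussianPDF 0 1 t := by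
  have hM (t : ℝ) : foldedMarginal S i Set.univ (t, z) = ENNReal.ofReal (Real.exp (-t ^ 2 / 2)) *
      (∫⋯∫⁻_{i}ᶜ, (fun x => ENNReal.ofReal (foldedKernel S⁻¹ x)) ∂fun _ => volume) 0 := by
    rw [← lmarginal_foldedKernel hS hdiag]
    simp [foldedMarginal]
  set K := (∫⋯∫⁻_{i}ᶜ, (fun x => ENNReal.ofReal (foldedKernel S⁻¹ x)) ∂fun _ => volume) 0
  set I := ∫⁻ t : ℝ, ENNReal.ofReal (Real.exp (-t ^ 2 / 2)) with hI
  have hm : Measurable fun t : ℝ => ENNReal.ofReal (Real.exp (-t ^ 2 / 2)) := by fun_prop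
  have hpdf (t : ℝ) : gaussianPDF 0 1 t =
      ENNReal.ofReal (√(2 * Real.pi))⁻¹ * ENNReal.ofReal (Real.exp (-t ^ 2 / 2)) := by
    rw [gaussianPDF, gaussianPDFReal, ← ENNReal.ofReal_mul (by positivity)]
    simp
  have h1 : ENNReal.ofReal (√(2 * Real.pi))⁻¹ * I = 1 := by
    rw [hI, ← lintegral_const_mul _ hm, ← lintegral_gaussianPDF_eq_one 0 (one_ne_zero (α := NNReal))]
    exact lintegral_congr fun t => (hpdf t).symm
  have h2 : foldedConst hS * K * I = 1 := by
    have := lintegral_foldedConst hS (F := 1) measurable_one (fun _ _ _ => rfl)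
    simp only [Pi.one_apply, lintegral_const, measure_univ, one_mul] at this
    rw [this, lintegral_eq_lintegral_lmarginal (measurable_foldedKernel _).ennreal_ofReal i]
    simp_rw [lmarginal_foldedKernel hS hdiag]
    rw [lintegral_mul_const _ hm]
    ring
  rw [hM, hpdf, ENNReal.eq_inv_of_mul_eq_one_left h1, ← ENNReal.eq_inv_of_mul_eq_one_left h2]
  ring

/-- The conditional probability of a section of a set `E` that is invariant under sign changes,
given the `i`-th coordinate. -/
def foldedConditional (hS : S.PosDef) (i : Fin n) (E : Set (EuclideanSpace ℝ (Fin n) × ℝ))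
    (p : ℝ × ℝ) : ℝ≥0∞ :=
  foldedConst hS * foldedMarginal S i E p / gaussianPDF 0 1 p.1

lemma measurable_foldedConditional (hS : S.PosDef) (hE : MeasurableSet E) (i : Fin n) :
    Measurable (foldedConditional hS i E) :=
  ((measurable_foldedMarginal hE i).const_mul _).div
    ((measurable_gaussianPDF 0 1).comp measurable_fst)

lemma gaussianPDF_ne_zero (t : ℝ) : gaussianPDF 0 1 t ≠ 0 :=
  (gaussianPDF_pos 0 one_ne_zero t).ne'

lemma gaussianPDF_ne_top (t : ℝ) : gaussianPDF 0 1 t ≠ ⊤ := ENNReal.ofReal_ne_top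

/-- Sign invariance of `E` and `A` permits the folded density in place of the Gaussian one; dividing
its section marginal by the standard normal density gives the conditional probability. -/
lemma multivariateGaussian_inter_eq_lintegral_folded (hS : S.PosDef) {i : Fin n}
    (hE : MeasurableSet E) {z : ℝ}
    (habs : ∀ x y : EuclideanSpace ℝ (Fin n), (∀ j, |x j| = |y j|) → (x, z) ∈ E → (y, z) ∈ E)
    {A : Set ℝ} (hA : MeasurableSet A) (hA' : ∀ t u : ℝ, |t| = |u| → t ∈ A → u ∈ A) :
    multivariateGaussian 0 S {x | (x, z) ∈ E ∧ x i ∈ A} =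
      ∫⁻ t in A, foldedConditional hS i E (t, z) ∂gaussianReal 0 1 := by
  set B : Set (Fin n → ℝ) := {x | (WithLp.toLp 2 x, z) ∈ E ∧ x i ∈ A} with hB
  have hBm : MeasurableSet B := (measurableSet_section hE z).inter (measurable_pi_apply i hA)
  have hBabs (x y : Fin n → ℝ) (h : ∀ j, |x j| = |y j|) (hx : x ∈ B) : y ∈ B :=
    ⟨habs (WithLp.toLp 2 x) (WithLp.toLp 2 y) h hx.1, hA' _ _ (h i) hx.2⟩
  have hset : {x : EuclideanSpace ℝ (Fin n) | (x, z) ∈ E ∧ x i ∈ A} = WithLp.ofLp ⁻¹' B := rfl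
  have hind (x : EuclideanSpace ℝ (Fin n)) : (WithLp.ofLp ⁻¹' B).indicator
      (1 : EuclideanSpace ℝ (Fin n) → ℝ≥0∞) x = B.indicator 1 (WithLp.ofLp x) := rfl
  rw [hset, ← lintegral_indicator_one (hBm.preimage (by fun_prop)), lintegral_congr hind,
    lintegral_foldedConst hS (measurable_one.indicator hBm)]
  swap
  · intro x y h
    by_cases hx : x ∈ B
    · rw [Set.indicator_of_mem hx, Set.indicator_of_mem (hBabs x y h hx)]
      rfl
    · rw [Set.indicator_of_notMem hx, Set.indicator_of_notMem
        fun hy => hx (hBabs y x (fun j => (h j).symm) hy)]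
  have hm : Measurable fun x => B.indicator 1 x * ENNReal.ofReal (foldedKernel S⁻¹ x) :=
    (measurable_one.indicator hBm).mul (measurable_foldedKernel _).ennreal_ofReal
  have hgm : Measurable fun t => foldedConditional hS i E (t, z) :=
    (measurable_foldedConditional hS hE i).comp measurable_prodMk_right
  rw [lintegral_eq_lintegral_lmarginal hm i, gaussianReal_of_var_ne_zero 0 one_ne_zero,
    setLIntegral_withDensity_eq_setLIntegral_mul _ (measurable_gaussianPDF 0 1) hgm hA,
    ← lintegral_indicator hA, ← lintegral_const_mul]
  · refine lintegral_congr fun t => ?_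
    have hval (y : ({i}ᶜ : Finset (Fin n)) → ℝ) :
        Function.updateFinset (Function.update (0 : Fin n → ℝ) i t) {i}ᶜ y i = t := by
      simp [Function.updateFinset]
    by_cases ht : t ∈ A
    · rw [Set.indicator_of_mem ht, Pi.mul_apply, foldedConditional,
        ENNReal.mul_div_cancel (gaussianPDF_ne_zero t) (gaussianPDF_ne_top t)]
      congr 1
      refine lintegral_congr fun y => ?_
      set x := Function.updateFinset (Function.update (0 : Fin n → ℝ) i t) {i}ᶜ y with hx
      by_cases hxE : (WithLp.toLp 2 x, z) ∈ E
      · have : x ∈ B := ⟨hxE, by rw [hx, hval]; exact ht⟩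
        dsimp only
        rw [Set.indicator_of_mem this, Set.indicator_of_mem (by exact hxE), Pi.one_apply, one_mul]
      · have : x ∉ B := fun h => hxE h.1
        dsimp only
        rw [Set.indicator_of_notMem this, Set.indicator_of_notMem (by exact hxE), zero_mul]
    · rw [Set.indicator_of_notMem ht]
      have : (∫⋯∫⁻_{i}ᶜ, (fun x => B.indicator 1 x * ENNReal.ofReal (foldedKernel S⁻¹ x))
          ∂fun _ => volume) (Function.update 0 i t) = 0 := by
        rw [lmarginal]
        refine lintegral_eq_zero_of_ae_eq_zero (ae_of_all _ fun y => ?_)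
        dsimp only
        rw [Set.indicator_of_notMem, zero_mul, Pi.zero_apply]
        intro h
        have := h.2
        rw [hval] at this
        exact ht this
      rw [this, mul_zero]
  · exact (hm.lmarginal _).comp (measurable_update _)

/-- Log-supermodularity is inherited by marginals of sections. -/
lemma foldedMarginal_mul_le {d : Fin n → ℤˣ}
    (hd : ∀ i j, i ≠ j → spin d i * spin d j * S⁻¹ i j ≤ 0) {i : Fin n}
    {E₁ E₂ E₃ E₄ : Set (EuclideanSpace ℝ (Fin n) × ℝ)} (h₁ : MeasurableSet E₁)
    (h₂ : MeasurableSet E₂) (h₃ : MeasurableSet E₃) (h₄ : MeasurableSet E₄) {z : ℝ}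
    (h : ∀ x y : Fin n → ℝ, (WithLp.toLp 2 x, z) ∈ E₁ → (WithLp.toLp 2 y, z) ∈ E₂ →
      (WithLp.toLp 2 (absSup x y), z) ∈ E₃ ∧ (WithLp.toLp 2 (absInf x y), z) ∈ E₄) (t u : ℝ) :
    foldedMarginal S i E₁ (t, z) * foldedMarginal S i E₂ (u, z) ≤
      foldedMarginal S i E₃ (if |u| ≤ |t| then t else u, z) *
        foldedMarginal S i E₄ (if |u| ≤ |t| then u else t, z) := by
  have e1 : absSup (0 : Fin n → ℝ) 0 = 0 := by ext; simp [absSup]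
  have e2 : absInf (0 : Fin n → ℝ) 0 = 0 := by ext; simp [absInf]
  have key := lmarginal_four_functions {i}ᶜ (measurable_section (S := S) h₁ z)
    (measurable_section (S := S) h₂ z) (measurable_section (S := S) h₃ z)
    (measurable_section (S := S) h₄ z) (fun x y => ?_)
    (Function.update 0 i t) (Function.update 0 i u)
  · rw [absSup_update, absInf_update, e1, e2] at key
    exact key
  · by_cases hx : (WithLp.toLp 2 x, z) ∈ E₁
    · by_cases hy : (WithLp.toLp 2 y, z) ∈ E₂
      · rw [Set.indicator_of_mem (by exact hx), Set.indicator_of_mem (by exact hy),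
          Set.indicator_of_mem (by exact (h x y hx hy).1),
          Set.indicator_of_mem (by exact (h x y hx hy).2),
          ← ENNReal.ofReal_mul (foldedKernel_pos _ _).le,
          ← ENNReal.ofReal_mul (foldedKernel_pos _ _).le]
        exact ENNReal.ofReal_le_ofReal (foldedKernel_mul_le d hd x y)
      · rw [Set.indicator_of_notMem (a := y) (by exact hy), mul_zero]
        exact zero_le
    · rw [Set.indicator_of_notMem (a := x) (by exact hx), zero_mul]
      exact zero_le

/-- The marginal over `Set.univ` is the normalizing density, so `hmul` is the cross-multiplied
comparison at fixed `z`; `hsub` then accounts for the change of `z`. -/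
lemma foldedConditional_le (hS : S.PosDef) (hdiag : ∀ i, S i i = 1) {i : Fin n} {t t' z z' : ℝ}
    (hmul : foldedMarginal S i E (t', z) * foldedMarginal S i Set.univ (t, z) ≤
      foldedMarginal S i E (t, z) * foldedMarginal S i Set.univ (t', z))
    (hsub : ∀ x, (x, z') ∈ E → (x, z) ∈ E) :
    foldedConditional hS i E (t', z') ≤ foldedConditional hS i E (t, z) := by
  have key : foldedMarginal S i E (t', z') * gaussianPDF 0 1 t ≤
      foldedMarginal S i E (t, z) * gaussianPDF 0 1 t' := by
    rw [← foldedConst_mul_foldedMarginal_univ hS hdiag i t z,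
      ← foldedConst_mul_foldedMarginal_univ hS hdiag i t' z, mul_left_comm, mul_left_comm _ _
        (foldedMarginal S i Set.univ (t', z))]
    exact mul_le_mul_right ((mul_le_mul_left (foldedMarginal_mono hsub) _).trans hmul) _
  unfold foldedConditional
  dsimp only
  rw [ENNReal.div_le_iff (gaussianPDF_ne_zero _) (gaussianPDF_ne_top _),
    ← ENNReal.mul_div_right_comm, ENNReal.le_div_iff_mul_le (Or.inl (gaussianPDF_ne_zero _))
      (Or.inl (gaussianPDF_ne_top _)), mul_assoc, mul_assoc]
  gcongr

lemma foldedConditional_antitone (hS : S.PosDef) (hdiag : ∀ i, S i i = 1) {d : Fin n → ℤˣ}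
    (hd : ∀ i j, i ≠ j → spin d i * spin d j * S⁻¹ i j ≤ 0) (hE : MeasurableSet E) {i : Fin n}
    {t t' z z' : ℝ} (ht : |t| ≤ |t'|)
    (hlow : ∀ x y : EuclideanSpace ℝ (Fin n), (∀ j, |y j| ≤ |x j|) → (x, z) ∈ E → (y, z) ∈ E)
    (hsub : ∀ x, (x, z') ∈ E → (x, z) ∈ E) :
    foldedConditional hS i E (t', z') ≤ foldedConditional hS i E (t, z) := by
  refine foldedConditional_le hS hdiag ?_ hsub
  -- Since `E` is a lower set in the absolute values, the smaller point `absInf x y` inherits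
  -- membership from `x`. For upper sets, `absSup` plays this role.
  have := foldedMarginal_mul_le hd hE MeasurableSet.univ MeasurableSet.univ hE (i := i) (z := z)
    (fun x y hx _ => ⟨trivial, hlow (WithLp.toLp 2 x) (WithLp.toLp 2 (absInf x y))
      (fun j => (abs_absInf x y j).trans_le (min_le_left _ _)) hx⟩) t' t
  rw [if_pos ht, if_pos ht] at this
  exact this.trans_eq (mul_comm _ _)

lemma foldedConditional_monotone (hS : S.PosDef) (hdiag : ∀ i, S i i = 1) {d : Fin n → ℤˣ}
    (hd : ∀ i j, i ≠ j → spin d i * spin d j * S⁻¹ i j ≤ 0) (hE : MeasurableSet E) {i : Fin n}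
    {t t' z z' : ℝ} (ht : |t'| ≤ |t|)
    (hup : ∀ x y : EuclideanSpace ℝ (Fin n), (∀ j, |x j| ≤ |y j|) → (x, z) ∈ E → (y, z) ∈ E)
    (hsub : ∀ x, (x, z') ∈ E → (x, z) ∈ E) :
    foldedConditional hS i E (t', z') ≤ foldedConditional hS i E (t, z) := by
  refine foldedConditional_le hS hdiag ?_ hsub
  have := foldedMarginal_mul_le hd MeasurableSet.univ hE hE MeasurableSet.univ (i := i) (z := z)
    (fun x y _ hy => ⟨hup (WithLp.toLp 2 y) (WithLp.toLp 2 (absSup x y))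
      (fun j => (le_max_right _ _).trans_eq (abs_absSup x y j).symm) hy, trivial⟩) t t'
  rw [if_pos ht, if_pos ht] at this
  exact (mul_comm _ _).trans_le this

/-- Up to sign, the absolute values of the Studentized vector satisfy the dependence condition. -/
lemma tailDependent_abs_studentized (hS : S.PosDef) (hdiag : ∀ i, S i i = 1) {d : Fin n → ℤˣ}
    (hd : ∀ i j, i ≠ j → spin d i * spin d j * S⁻¹ i j ≤ 0) {ν : ℝ} (hν : 0 < ν)
    {s : ℝ} (hs : s = 1 ∨ s = -1) (a : Fin n → ℝ) :
    TailDependent ((multivariateGaussian 0 S).prod (scaledChiMeasure ν))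
      (fun i p => s * |p.2⁻¹ * p.1 i|) a := by
  intro i r u t hut _
  have hT : Measurable fun x : ℝ => s * |x| := by fun_prop
  have hE := measurableSet_tailEvent
    (fun i => measurable_studentized (fun x => s * |x|) hT i) a i r
  refine ratio_of_conditional hν hT (multivariateGaussian_eval hS.posSemidef hdiag i) hE
    (measurable_foldedConditional hS hE i) (fun z t _ => ?_) hut ?_
  · refine multivariateGaussian_inter_eq_lintegral_folded hS hE (fun x y hxy => ?_)
      (A := {x | s * |z⁻¹ * x| < t}) (measurableSet_lt (by fun_prop) measurable_const) ?_
    · refine tailEvent_of_forall fun j k _ hjk => ?_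
      simpa only [abs_mul, hxy] using hjk
    · intro x y hxy hx
      simpa only [Set.mem_ofPred_eq, abs_mul, hxy] using hx
  · intro y y' w hy hy' _ hw
    have hθ : 0 < √(w / (ν + y ^ 2)) := Real.sqrt_pos.mpr (by positivity)
    have hθ' : 0 < √(w / (ν + y' ^ 2)) := Real.sqrt_pos.mpr (by positivity)
    have hyy : s * |y| ≤ s * |y'| := (hy.trans_le hy').le
    rcases hs with rfl | rfl
    · rw [one_mul, one_mul] at hyy
      -- For `s = 1` the tail event is a lower set in the absolute values and grows with `z`; for `s
      -- = -1` it is an upper set and grows as `z` falls.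
      have h1 := sqrt_div_le_of_abs_le hν hw hyy
      have h2 := sqrt_div_mul_abs_le hν hw hyy
      refine foldedConditional_antitone hS hdiag hd hE ?_ (fun x y hxy => ?_) fun x => ?_
      · rwa [abs_mul, abs_mul, abs_of_pos hθ, abs_of_pos hθ']
      · refine tailEvent_of_forall fun j k _ hjk => ?_
        dsimp only at hjk ⊢
        refine lt_of_le_of_lt ?_ hjk
        rw [abs_mul, abs_mul, one_mul, one_mul]
        exact mul_le_mul_of_nonneg_left (hxy j) (abs_nonneg _)
      · refine tailEvent_of_forall fun j k _ hjk => ?_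
        dsimp only at hjk ⊢
        refine lt_of_le_of_lt ?_ hjk
        rw [abs_mul, abs_mul, abs_of_pos (inv_pos.mpr hθ), abs_of_pos (inv_pos.mpr hθ')]
        gcongr
    · replace hyy : |y'| ≤ |y| := by linarith
      have h1 := sqrt_div_le_of_abs_le hν hw hyy
      have h2 := sqrt_div_mul_abs_le hν hw hyy
      refine foldedConditional_monotone hS hdiag hd hE ?_ (fun x y hxy => ?_) fun x => ?_
      · rwa [abs_mul, abs_mul, abs_of_pos hθ, abs_of_pos hθ']
      · refine tailEvent_of_forall fun j k _ hjk => ?_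
        dsimp only at hjk ⊢
        refine lt_of_le_of_lt ?_ hjk
        rw [abs_mul, abs_mul, neg_one_mul, neg_one_mul, neg_le_neg_iff]
        exact mul_le_mul_of_nonneg_left (hxy j) (abs_nonneg _)
      · refine tailEvent_of_forall fun j k _ hjk => ?_
        dsimp only at hjk ⊢
        refine lt_of_le_of_lt ?_ hjk
        rw [abs_mul, abs_mul, abs_of_pos (inv_pos.mpr hθ), abs_of_pos (inv_pos.mpr hθ'),
          neg_one_mul, neg_one_mul, neg_le_neg_iff]
        gcongr

end Folded

end Simes

end

/-! ### Assembly of the theorem. -/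

noncomputable section

namespace Simes

lemma exists_spin_of_diagonal {n : ℕ} {Q : Matrix (Fin n) (Fin n) ℝ}
    (h : ∃ d : Fin n → ℝ, (∀ i, d i = 1 ∨ d i = -1) ∧
      ∀ i j, i ≠ j → 0 ≤ (-(Matrix.diagonal d * Q * Matrix.diagonal d)) i j) :
    ∃ d : Fin n → ℤˣ, ∀ i j, i ≠ j → spin d i * spin d j * Q i j ≤ 0 := by
  obtain ⟨d, hd, h⟩ := h
  have (i : Fin n) : ∃ e : ℤˣ, d i = ((e : ℤ) : ℝ) := by
    rcases hd i with h | h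
    · exact ⟨1, by simp [h]⟩
    · exact ⟨-1, by simp [h]⟩
  choose e he using this
  refine ⟨e, fun i j hij => ?_⟩
  have := h i j hij
  rw [Matrix.neg_apply, Matrix.mul_diagonal, Matrix.diagonal_mul, he, he] at this
  simp only [spin]
  linarith

end Simes

end

theorem theorem3p1 {Ω : Type*} [MeasurableSpace Ω] (P : Measure Ω) [IsProbabilityMeasure P]
    {n : ℕ} (hn : 0 < n) (S : Matrix (Fin n) (Fin n) ℝ) (hS : S.PosSemidef)
    (hdiag : ∀ i, S i i = 1) (ν : ℝ) (hν : 0 < ν)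
    (X : Ω → EuclideanSpace ℝ (Fin n)) (Z : Ω → ℝ)
    (hX : HasLaw X (multivariateGaussian 0 S) P)
    (hZ : HasLaw Z (Simes.scaledChiMeasure ν) P)
    (hXZ : IndepFun X Z P)
    (T : Fin n → Ω → ℝ) (hT : ∀ i ω, T i ω = (Z ω)⁻¹ * X ω i) :
    ((∀ i j, i ≠ j → 0 ≤ S i j) →
      (∀ a : Fin n → ℝ, Simes.LowerAdmissible P T a → a (Simes.lastIdx hn) ≤ 0 →
        Simes.LowerInequality hn P T a) ∧
      (∀ b : Fin n → ℝ, Simes.UpperAdmissible P T b → 0 ≤ b (Simes.firstIdx hn) →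
        Simes.UpperInequality hn P T b)) ∧
    (S.PosDef →
      (∃ d : Fin n → ℝ, (∀ i, d i = 1 ∨ d i = -1) ∧
        ∀ i j, i ≠ j → 0 ≤ (-(Matrix.diagonal d * S⁻¹ * Matrix.diagonal d)) i j) →
      (∀ a : Fin n → ℝ, Simes.LowerAdmissible P (fun i ω => |T i ω|) a →
        Simes.LowerInequality hn P (fun i ω => |T i ω|) a) ∧
      (∀ b : Fin n → ℝ, Simes.UpperAdmissible P (fun i ω => |T i ω|) b →
        Simes.UpperInequality hn P (fun i ω => |T i ω|) b)) := by
  have hV : AEMeasurable (fun ω => (X ω, Z ω)) P := hX.aemeasurable.prodMk hZ.aemeasurable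
  have hlaw : P.map (fun ω => (X ω, Z ω)) =
      (multivariateGaussian 0 S).prod (Simes.scaledChiMeasure ν) := by
    rw [(indepFun_iff_map_prod_eq_prod_map_map hX.aemeasurable hZ.aemeasurable).mp hXZ,
      hX.map_eq, hZ.map_eq]
  have := Simes.isProbabilityMeasure_scaledChiMeasure hν
  set Y : Fin n → EuclideanSpace ℝ (Fin n) × ℝ → ℝ := fun i p => p.2⁻¹ * p.1 i with hYdef
  obtain rfl : T = fun i ω => Y i (X ω, Z ω) := by
    ext i ω
    exact hT i ω
  have hY (i : Fin n) : Measurable (Y i) := Simes.measurable_studentized id measurable_id i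
  have hYa (i : Fin n) : Measurable fun p => |Y i p| :=
    Simes.measurable_studentized (fun x => |x|) (by fun_prop) i
  have hatom (i : Fin n) (t : ℝ) :
      ((multivariateGaussian 0 S).prod (Simes.scaledChiMeasure ν)) {p | Y i p = t} = 0 :=
    Simes.prod_ratio_eq_zero hν (Simes.multivariateGaussian_eval hS hdiag i) t
  have hatom' (i : Fin n) (t : ℝ) :
      ((multivariateGaussian 0 S).prod (Simes.scaledChiMeasure ν)) {p | |Y i p| = t} = 0 := by
    -- A level set of the absolute value lies in two level sets of the ratio.
    refine measure_mono_null (fun p hp => ?_) (measure_union_null (hatom i t) (hatom i (-t)))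
    have hp' : |Y i p| = t := hp
    rcases abs_choice (Y i p) with h | h
    · exact Or.inl (h.symm.trans hp')
    · exact Or.inr (show Y i p = -t by linarith)
  refine ⟨fun hpos => ⟨fun a ha ha0 => ?_, fun b hb hb0 => ?_⟩,
    fun hSd hd => ⟨fun a ha => ?_, fun b hb => ?_⟩⟩
  · rw [Simes.lowerAdmissible_comp hV hY, hlaw] at ha
    refine Simes.lowerInequality_comp hn hV hY ?_
    rw [hlaw]
    refine Simes.lowerInequality_of_tailDependent hn _ hY hatom ha ?_
    have hle (k : Fin n) : a k ≤ 0 :=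
      (ha.1 (Fin.le_def.mpr (by simp only [Simes.lastIdx]; omega))).trans ha0
    simpa only [one_mul] using
      Simes.tailDependent_studentized hS hdiag hpos hν (Or.inl rfl) hle
  · rw [Simes.upperAdmissible_comp hV hY, hlaw] at hb
    refine Simes.upperInequality_comp hn hV hY ?_
    rw [hlaw]
    refine Simes.upperInequality_of_tailDependent hn _ hY hb ?_
    have hle (k : Fin n) : -b k.rev ≤ 0 := neg_nonpos.mpr
      (hb0.trans (hb.1 (Fin.le_def.mpr (by simp only [Simes.firstIdx]; omega))))
    simpa only [neg_one_mul] using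
      Simes.tailDependent_studentized hS hdiag hpos hν (Or.inr rfl) hle
  · obtain ⟨d, hd⟩ := Simes.exists_spin_of_diagonal hd
    rw [Simes.lowerAdmissible_comp (Y := fun i p => |Y i p|) hV hYa, hlaw] at ha
    refine Simes.lowerInequality_comp (Y := fun i p => |Y i p|) hn hV hYa ?_
    rw [hlaw]
    refine Simes.lowerInequality_of_tailDependent hn _ hYa hatom' ha ?_
    simpa only [one_mul] using
      Simes.tailDependent_abs_studentized hSd hdiag hd hν (Or.inl rfl) a
  · obtain ⟨d, hd⟩ := Simes.exists_spin_of_diagonal hd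
    rw [Simes.upperAdmissible_comp (Y := fun i p => |Y i p|) hV hYa, hlaw] at hb
    refine Simes.upperInequality_comp (Y := fun i p => |Y i p|) hn hV hYa ?_
    rw [hlaw]
    refine Simes.upperInequality_of_tailDependent hn _ hYa hb ?_
    simpa only [neg_one_mul] using
      Simes.tailDependent_abs_studentized hSd hdiag hd hν (Or.inr rfl) fun j => -b j.rev
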